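/- Let $\mathbb{K}$ be an algebraically closed field of characteristic zero. Let $p_1,\dots,p_4\in\mathbb{K}[t_1,t_2,t_3]$ be homogeneous polynomials of the same degree with $\gcd(p_1,\dots,p_4)=1$, defining a rational map $\mathcal{P}=(p_1:\cdots:p_4):\mathbb{P}^2(\mathbb{K})\dashrightarrow\mathbb{P}^3(\mathbb{K})$ (for instance, a rational parametrization of a surface). Assume that $p_4\neq 0$ and that $(0:0:1)$ lies on none of the curves $\{p_i=0\}$, for those $i$ with $p_i\ne 0$. Let $\mathscr{B}(\mathcal{P})\subset\mathbb{P}^2(\mathbb{K})$ be the set of base points, that is, of the points $A$ with $p_1(A)=\cdots=p_4(A)=0$. Let $\overline{x}=(x_1,\dots,x_4)$ and $\overline{y}=(y_1,\dots,y_4)$ be independent indeterminates, and let $\mathbb{F}$ be the algebraic closure of $\mathbb{K}(\overline{x},\overline{y})$. For a projective transformation $L=(L_1:\cdots:L_4)$ of $\mathbb{P}^3(\mathbb{K})$, given by an invertible $4\times4$ matrix over $\mathbb{K}$, put $$W_1^L=\sum_{i=1}^4 x_i\,L_i(p_1,\dots,p_4),\qquad W_2^L=\sum_{i=1}^4 y_i\,L_i(p_1,\dots,p_4),$$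 and write $W_1,W_2$ for these polynomials when $L$ is the identity. The multiplicity of the base locus is $$\mathrm{mult}(\mathscr{B}(\mathcal{P}))=\sum_{A\in\mathscr{B}(\mathcal{P})}\dim_{\mathbb{F}}\mathcal{O}_{\mathbb{P}^2(\mathbb{F}),A}/\langle \widetilde W_1,\widetilde W_2\rangle,$$ where $\widetilde W_i$ is a local equation at $A$ of the curve $\{W_i=0\}\subset\mathbb{P}^2(\mathbb{F})$; that is, it is the sum over the base points of the intersection multiplicities of the curves $\{W_1=0\}$ and $\{W_2=0\}$. Then $\mathscr{B}(\mathcal{P})$ is finite and, for every projective transformation $L$ of $\mathbb{P}^3(\mathbb{K})$, $$\mathrm{mult}(\mathscr{B}(\mathcal{P}))=\deg_{(t_1,t_2)}\Big(\mathrm{Content}_{\{\overline{x},\overline{y}\}}\big(\mathrm{Res}_{t_3}(W_1^L,W_2^L)\big)\Big),$$ where $\mathrm{Res}_{t_3}$ is the resultant with respect to $t_3$, and the content of a polynomial in $\mathbb{K}[t_1,t_2][\overline{x},\overline{y}]$ is the greatest common divisor in $\mathbb{K}[t_1,t_2]$ of its coefficients. -/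

import Mathlib

noncomputable section

namespace BaseLocus

open MvPolynomial

universe u

variable {K : Type u} [Field K]

/-- The index set of the indeterminates `x₁, …, x₄` (left summand) and `y₁, …, y₄`
(right summand). -/
abbrev XY : Type := Fin 4 ⊕ Fin 4

/-- The polynomial ring `K[x, y]`. -/
abbrev KXY (K : Type u) [Field K] : Type u := MvPolynomial XY K

/-- The field `𝔽`: the algebraic closure of `K(x, y)`. -/
abbrev BigF (K : Type u) [Field K] : Type u := AlgebraicClosure (FractionRing (KXY K))

/-! ### The parametrization and its base points -/

/-- A quadruple of polynomials has greatest common divisor `1`. -/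
def GcdEqOne (p : Fin 4 → MvPolynomial (Fin 3) K) : Prop :=
  ∀ d : MvPolynomial (Fin 3) K, (∀ i, d ∣ p i) → IsUnit d

/-- The base points of `(p₁ : p₂ : p₃ : p₄)`. For homogeneous `pᵢ` the condition does not depend
on the chosen homogeneous coordinates. -/
def basePoints (p : Fin 4 → MvPolynomial (Fin 3) K) :
    Set (Projectivization K (Fin 3 → K)) :=
  {A | ∀ i, eval A.rep (p i) = 0}

/-- The composition `L ∘ P`, where the projective transformation `L` of `ℙ³(K)` is represented by
an invertible `4 × 4` matrix: its components are the `Lᵢ(P)`. -/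
def transform (L : GL (Fin 4) K) (p : Fin 4 → MvPolynomial (Fin 3) K) :
    Fin 4 → MvPolynomial (Fin 3) K :=
  fun i => ∑ j, C ((L : Matrix (Fin 4) (Fin 4) K) i j) * p j

/-- `W₁ = ∑ xᵢ qᵢ` as an element of `K[x, y][t₁, t₂, t₃]`. -/
def W₁ (q : Fin 4 → MvPolynomial (Fin 3) K) : MvPolynomial (Fin 3) (KXY K) :=
  ∑ i, C (X (Sum.inl i)) * map C (q i)

/-- `W₂ = ∑ yᵢ qᵢ` as an element of `K[x, y][t₁, t₂, t₃]`. -/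
def W₂ (q : Fin 4 → MvPolynomial (Fin 3) K) : MvPolynomial (Fin 3) (KXY K) :=
  ∑ i, C (X (Sum.inr i)) * map C (q i)

/-! ### Intersection multiplicity of projective plane curves -/

section Intersection

variable {F : Type u} [Field F]

/-- The index of the first nonzero coordinate of a nonzero vector `v`. The point of the projective
plane with homogeneous coordinates `v` lies in the corresponding standard affine chart. -/
def chart (v : Fin 3 → F) : Fin 3 :=
  open Classical in if v 0 ≠ 0 then 0 else if v 1 ≠ 0 then 1 else 2

/-- Dehomogenization with respect to the variable `t_k`: substitute `t_k = 1`, and let the two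
remaining variables, in their order, be the affine coordinates. -/
def dehomogenize (k : Fin 3) : MvPolynomial (Fin 3) F →ₐ[F] MvPolynomial (Fin 2) F :=
  aeval (k.insertNth (1 : MvPolynomial (Fin 2) F) (fun j : Fin 2 => X j))

/-- The affine coordinates, in the chart `t_k ≠ 0`, of the point with homogeneous
coordinates `v`. -/
def affinePoint (k : Fin 3) (v : Fin 3 → F) : Fin 2 → F :=
  fun j => v (k.succAbove j) / v k

/-- The ideal of polynomials that vanish at the point `a` of the affine plane. -/
abbrev pointIdeal (a : Fin 2 → F) : Ideal (MvPolynomial (Fin 2) F) :=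
  RingHom.ker (eval a)

instance pointIdeal_isPrime (a : Fin 2 → F) : (pointIdeal a).IsPrime :=
  RingHom.ker_isPrime _

/-- The local ring of the affine plane at the point `a`. -/
abbrev LocalRingAt (a : Fin 2 → F) : Type u := Localization.AtPrime (pointIdeal a)

/-- The multiplicity of intersection at the point `a` of the affine plane of the affine
curves `f = 0` and `g = 0`: the dimension `dim_F 𝒪_a / ⟨f, g⟩`, possibly infinite. -/
def affineMult (f g : MvPolynomial (Fin 2) F) (a : Fin 2 → F) : ℕ∞ :=
  Cardinal.toENat (Module.rank F
    (LocalRingAt a ⧸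
      (Ideal.span {algebraMap (MvPolynomial (Fin 2) F) (LocalRingAt a) f,
        algebraMap (MvPolynomial (Fin 2) F) (LocalRingAt a) g} : Ideal (LocalRingAt a))))

/-- The multiplicity of intersection of the projective plane curves `f = 0` and `g = 0` (with `f`
and `g` homogeneous) at the point with homogeneous coordinates `v`, computed from local equations
of the curves in an affine chart that contains the point. -/
def intersectionMult (f g : MvPolynomial (Fin 3) F) (v : Fin 3 → F) : ℕ∞ :=
  affineMult (dehomogenize (chart v) f) (dehomogenize (chart v) g) (affinePoint (chart v) v)

end Intersection

/-- The multiplicity of the base point `A`: the multiplicity of intersection at `A` of the curves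
`W₁ = 0` and `W₂ = 0` in `ℙ²(𝔽)`. -/
def basePointMult (p : Fin 4 → MvPolynomial (Fin 3) K)
    (A : Projectivization K (Fin 3 → K)) : ℕ∞ :=
  intersectionMult (map (algebraMap (KXY K) (BigF K)) (W₁ p))
    (map (algebraMap (KXY K) (BigF K)) (W₂ p))
    (fun j => algebraMap K (BigF K) (A.rep j))

/-- The multiplicity of the base locus: the sum of the multiplicities of the base points. -/
def baseLocusMult (p : Fin 4 → MvPolynomial (Fin 3) K) : ℕ∞ :=
  ∑ᶠ A ∈ basePoints p, basePointMult p A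

/-! ### Resultant and content -/

/-- The ring `K[t₁, t₂][x, y]`. -/
abbrev KTXY (K : Type u) [Field K] : Type u := MvPolynomial XY (MvPolynomial (Fin 2) K)

/-- The rearrangement `K[x, y][t₁, t₂, t₃] → K[t₁, t₂][x, y][t₃]`. -/
def asPolyT₃ : MvPolynomial (Fin 3) (KXY K) →+* Polynomial (KTXY K) :=
  eval₂Hom (Polynomial.C.comp (map C))
    ![Polynomial.C (C (X 0)), Polynomial.C (C (X 1)), Polynomial.X]

/-- The resultant with respect to `t₃`, as an element of `K[t₁, t₂][x, y]`. -/
def resT₃ (f g : MvPolynomial (Fin 3) (KXY K)) : KTXY K :=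
  Polynomial.resultant (asPolyT₃ f) (asPolyT₃ g)

/-- The content with respect to `{x, y}`: the greatest common divisor in `K[t₁, t₂]` of the
coefficients (unique up to a nonzero constant factor). -/
def contentXY (R : KTXY K) : MvPolynomial (Fin 2) K :=
  letI : NormalizedGCDMonoid (MvPolynomial (Fin 2) K) := Classical.choice inferInstance
  R.support.gcd (fun m => R.coeff m)

end BaseLocus

end

noncomputable section

namespace BaseLocus

open Polynomial Module

/-! ### Smith normal form over `F[X]` and the `c`-primary part of a cokernel -/

section SmithForm

variable {F : Type*} [Field F] {ι : Type*} [Fintype ι]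

/-! Project the plane from `(0:0:1)` to the line with coordinates `(t₁:t₂)`. As `p₄` does not vanish
at the centre, `W₁` and `W₂` have degree `n` in `t₃` with leading coefficients in `K[x, y]`. So the
resultant `R` commutes with restriction to either affine chart of the line, and its coefficients in
`x, y` are binary forms of degree `n²`.

One independence argument (`aeval_eq_zero_of_sum_eq_zero`) serves twice: if `∑ xᵢ qᵢ(z) = ∑ yᵢ qᵢ(z)
= 0`, the second relation makes `z` algebraic over the field generated by the `yᵢ`, over which the
`xᵢ` stay independent, so every `qᵢ(z)` vanishes. Over the fraction field of `K[t₁, t₂]` this and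
the gcd hypothesis give `R ≠ 0`. On a line through the centre that is defined over `K`, it shows
that the two generic curves meet only in base points.

The content `H` of `R` is a nonzero binary form, so its degree counts its zeros on the projective
line. At each point `c` defined over `K`, `H` and `R` vanish to the same order `e`
(`rootMultiplicity_lineSpec`), because `R / H` restricted to `c` is a nonzero polynomial in `x, y`.
This `e` is the sum of the intersection multiplicities over the points above `c`
(`sum_affineMult_eq_rootMultiplicity_resultant`): by Smith normal form, the cokernel of the
Sylvester map modulo `(s - c)ᵉ` has dimension `e`. That cokernel is `F[s, z] / (f, g, (s - c)ᵉ)`, an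
Artinian algebra, hence the product of its local rings; and in each local ring `(s - c)ᵉ` already
lies in `(f, g)`. Summation over the zeros of `H` settles the case `L = 1`.

A general `L` acts on `R` by an invertible linear substitution in the `xᵢ` and in the `yᵢ`, which
preserves the content up to a unit. -/

theorem rootMultiplicity_prod {p : ι → F[X]} (hp : ∀ i, p i ≠ 0) (c : F) :
    rootMultiplicity c (∏ i, p i) = ∑ i, rootMultiplicity c (p i) := by
  classical
  simp only [← count_roots]
  rw [roots_prod _ _ (Finset.prod_ne_zero_iff.2 fun i _ => hp i), Multiset.count_bind]
  rfl

variable [DecidableEq ι]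
  {M' M S : Type*} [AddCommGroup M'] [AddCommGroup M] [AddCommGroup S]
  [Module F[X] M'] [Module F[X] M] [Module F[X] S] [Module F S] [IsScalarTower F F[X] S]

/-- A linear map between free modules over a principal ideal domain with nonzero determinant is,
up to the choice of bases, a diagonal matrix. -/
theorem exists_diagonal_basis {R : Type*} [CommRing R] [IsDomain R] [IsPrincipalIdealRing R]
    [Module R M'] [Module R M]
    (b' : Basis ι R M') (b : Basis ι R M) (φ : M' →ₗ[R] M)
    (h : (LinearMap.toMatrix b' b φ).det ≠ 0) :
    ∃ (b₂ : Basis ι R M) (a : ι → R),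
      Associated (LinearMap.toMatrix b' b φ).det (∏ i, a i) ∧
      (∀ i, a i • b₂ i ∈ LinearMap.range φ) ∧ ∀ y i, a i ∣ b₂.repr (φ y) i := by
  have hinj : Function.Injective φ := by
    rw [← LinearMap.ker_eq_bot, LinearMap.ker_eq_bot']
    intro m hm
    have h1 : (LinearMap.toMatrix b' b φ).mulVec (b'.repr m) = 0 := by
      rw [LinearMap.toMatrix_mulVec_repr, hm]; simp
    have h2 := Matrix.eq_zero_of_mulVec_eq_zero h h1
    have h3 : b'.repr m = 0 := by ext i; simpa using congrFun h2 i
    simpa using h3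
  have hrank : finrank R (LinearMap.range φ) = finrank R M := by
    rw [LinearMap.finrank_range_of_inj hinj, finrank_eq_card_basis b', finrank_eq_card_basis b]
  obtain ⟨b₂, a, ab, hab⟩ := Submodule.exists_smith_normal_form_of_rank_eq b hrank
  refine ⟨b₂, a, ?_, fun i => hab i ▸ (ab i).2, fun y i => ?_⟩
  swap
  · have h1 : φ y = ∑ j, (ab.repr ⟨φ y, y, rfl⟩ j) • (a j • b₂ j) := by
      have h2 := congrArg Subtype.val (ab.sum_repr ⟨φ y, y, rfl⟩)
      simp only [AddSubmonoidClass.coe_finsetSum, Submodule.coe_smul, hab] at h2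
      exact h2.symm
    rw [h1]
    simp only [map_sum, map_smul, Basis.repr_self, Finsupp.coe_finsetSum, Finset.sum_apply,
      Finsupp.smul_apply, Finsupp.single_apply, smul_eq_mul, mul_ite, mul_one, mul_zero,
      Finset.sum_ite_eq', Finset.mem_univ, if_true]
    exact dvd_mul_left _ _
  let e := LinearEquiv.ofInjective φ hinj
  have hφ : φ = (LinearMap.id ∘ₗ (LinearMap.range φ).subtype) ∘ₗ (e : M' →ₗ[R] _) := by
    ext x; rfl
  have hdiag : LinearMap.toMatrix ab b₂ (LinearMap.range φ).subtype = Matrix.diagonal a := by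
    ext i j
    rw [LinearMap.toMatrix_apply, Submodule.subtype_apply, hab, map_smul, Basis.repr_self]
    simp only [Finsupp.smul_apply, Finsupp.single_apply, smul_eq_mul, Matrix.diagonal_apply]
    by_cases hij : i = j
    · subst hij; simp
    · simp [hij, Ne.symm hij]
  -- The outer factors are matrices of isomorphisms, so only the diagonal contributes to the
  -- determinant up to a unit.
  have key : (LinearMap.toMatrix b' b φ) =
      LinearMap.toMatrix b₂ b (LinearMap.id : M →ₗ[R] M) * Matrix.diagonal a *
        LinearMap.toMatrix b' ab (e : M' →ₗ[R] _) := by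
    rw [← hdiag, ← LinearMap.toMatrix_comp, ← LinearMap.toMatrix_comp, ← hφ]
  have u1 : IsUnit (LinearMap.toMatrix b₂ b (LinearMap.id : M →ₗ[R] M)).det :=
    LinearEquiv.isUnit_det (LinearEquiv.refl R M) b₂ b
  have u2 : IsUnit (LinearMap.toMatrix b' ab (e : M' →ₗ[R] _)).det :=
    LinearEquiv.isUnit_det e b' ab
  rw [key, Matrix.det_mul, Matrix.det_mul, Matrix.det_diagonal]
  rw [mul_right_comm, mul_comm]
  exact associated_mul_unit_left _ _ (u1.mul u2)

theorem rootMultiplicity_eq_of_associated {p q : F[X]} (h : Associated p q) (c : F) :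
    rootMultiplicity c p = rootMultiplicity c q := by
  obtain ⟨u, rfl⟩ := h
  by_cases hp : p = 0
  · simp [hp]
  rw [rootMultiplicity_mul (mul_ne_zero hp u.ne_zero)]
  obtain ⟨r, hr, hu⟩ := Polynomial.isUnit_iff.1 u.isUnit
  rw [← hu, rootMultiplicity_C, add_zero]

/-- The `c`-primary part of the cokernel of a matrix `D` over `F[X]` has dimension the
multiplicity of `c` as a root of `det D`. -/
theorem finrank_eq_rootMultiplicity_det
    (b' : Basis ι F[X] M') (b : Basis ι F[X] M) (φ : M' →ₗ[F[X]] M)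
    (h : (LinearMap.toMatrix b' b φ).det ≠ 0) (c : F)
    (ψ : M →ₗ[F[X]] S) (hψ : Function.Surjective ψ)
    (hker : ∀ x, ψ x = 0 ↔ ∃ y z, x = φ y +
      (X - C c) ^ (rootMultiplicity c (LinearMap.toMatrix b' b φ).det) • z) :
    Module.Finite F S ∧ finrank F S = rootMultiplicity c (LinearMap.toMatrix b' b φ).det := by
  obtain ⟨b₂, a, hdet, hmem, hdvd⟩ := exists_diagonal_basis b' b φ h
  have ha : ∀ i, a i ≠ 0 := fun i hi => h <|
    (hdet.eq_zero_iff).2 (Finset.prod_eq_zero (Finset.mem_univ i) hi)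
  have he : rootMultiplicity c (LinearMap.toMatrix b' b φ).det =
      ∑ i, rootMultiplicity c (a i) := by
    rw [rootMultiplicity_eq_of_associated hdet, rootMultiplicity_prod ha]
  set e := rootMultiplicity c (LinearMap.toMatrix b' b φ).det with hedef
  set E : ι → ℕ := fun i => rootMultiplicity c (a i) with hE
  have hEe : ∀ i, E i ≤ e := fun i =>
    he ▸ Finset.single_le_sum (f := E) (fun _ _ => Nat.zero_le _) (Finset.mem_univ i)
  -- Explicit model of `S`: each invariant factor `a i` contributes its `(X - c)`-part, of dimension
  -- `E i`, and the `E i` add up to `e`.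
  let θ : M →ₗ[F[X]] (∀ i, F[X] ⧸ Ideal.span {(X - C c) ^ E i}) :=
    LinearMap.pi fun i => (Submodule.mkQ _) ∘ₗ b₂.coord i
  have hθ0 : ∀ x, θ x = 0 ↔ ∀ i, (X - C c) ^ E i ∣ b₂.repr x i := by
    intro x
    rw [funext_iff]
    refine forall_congr' fun i => ?_
    exact Ideal.Quotient.eq_zero_iff_dvd _ _
  have hθ : Function.Surjective θ := by
    intro w
    have hw : ∀ i, ∃ v : F[X], Ideal.Quotient.mk _ v = w i := fun i =>
      Ideal.Quotient.mk_surjective (w i)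
    choose v hv using hw
    refine ⟨b₂.equivFun.symm v, funext fun i => ?_⟩
    rw [← hv i]
    exact congrArg (Ideal.Quotient.mk _) (congrFun (b₂.equivFun.apply_symm_apply v) i)
  have hkk : LinearMap.ker ψ = LinearMap.ker θ := by
    ext x
    rw [LinearMap.mem_ker, LinearMap.mem_ker, hker, hθ0]
    constructor
    · rintro ⟨y, z, rfl⟩ i
      rw [map_add, map_smul, Finsupp.add_apply, Finsupp.smul_apply, smul_eq_mul]
      exact dvd_add ((pow_rootMultiplicity_dvd _ _).trans (hdvd y i))
        ((pow_dvd_pow _ (hEe i)).trans (dvd_mul_right _ _))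
    · intro hx
      choose v hv using hx
      have key : ∀ i, ∃ y z, b₂.repr x i • b₂ i = φ y + (X - C c) ^ e • z := by
        intro i
        obtain ⟨u, hu, hnu⟩ := exists_eq_pow_rootMultiplicity_mul_and_not_dvd (a i) (ha i) c
        obtain ⟨y, hy⟩ := hmem i
        -- By Bézout for the cofactor `u` of `a i`, the power `(X - c) ^ E i` lies in the ideal
        -- generated by `a i` and `(X - c) ^ e`.
        have hcop : IsCoprime u ((X - C c) ^ (e - E i)) :=
          (((irreducible_X_sub_C c).coprime_iff_not_dvd.2 hnu).pow_left).symm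
        obtain ⟨s, t, hst⟩ := hcop
        refine ⟨(s * v i) • y, (t * v i) • b₂ i, ?_⟩
        rw [map_smul, hy, smul_smul, smul_smul, ← add_smul, hv i]
        congr 1
        have h2 : (X - C c) ^ e = (X - C c) ^ E i * (X - C c) ^ (e - E i) := by
          rw [← pow_add, Nat.add_sub_cancel' (hEe i)]
        rw [h2]
        have hu' : a i = (X - C c) ^ E i * u := hu
        linear_combination (-(X - C c) ^ E i * v i) * hst - s * v i * hu'
      choose y z hyz using key
      refine ⟨∑ i, y i, ∑ i, z i, ?_⟩
      rw [map_sum, Finset.smul_sum, ← Finset.sum_add_distrib]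
      simp only [← hyz]
      exact (b₂.sum_repr x).symm
  let eqv : S ≃ₗ[F[X]] (∀ i, F[X] ⧸ Ideal.span {(X - C c) ^ E i}) :=
    (LinearMap.quotKerEquivOfSurjective ψ hψ).symm ≪≫ₗ
      Submodule.quotEquivOfEq _ _ hkk ≪≫ₗ LinearMap.quotKerEquivOfSurjective θ hθ
  have hfin : ∀ i, Module.Finite F (F[X] ⧸ Ideal.span {(X - C c) ^ E i}) := fun i =>
    ((monic_X_sub_C c).pow (E i)).finite_quotient
  let eqvF := eqv.restrictScalars F
  refine ⟨Module.Finite.equiv eqvF.symm, ?_⟩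
  rw [eqvF.finrank_eq, finrank_pi_fintype, he]
  refine Finset.sum_congr rfl fun i _ => ?_
  rw [finrank_quotient_span_eq_natDegree, natDegree_pow, natDegree_X_sub_C, mul_one]

end SmithForm

end BaseLocus

namespace BaseLocus

open Polynomial Module

/-! ### The resultant as the determinant of the Sylvester map -/

section Resultant

/-- Division with remainder by a polynomial whose leading coefficient is a unit. -/
theorem exists_eq_mul_add_of_isUnit_leadingCoeff {R : Type*} [CommRing R] [Nontrivial R]
    {f : R[X]} (hf : IsUnit f.leadingCoeff) (p : R[X]) :
    ∃ q r : R[X], p = f * q + r ∧ r.degree < f.natDegree := by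
  obtain ⟨u, hu⟩ := hf.exists_left_inv
  have hmon : (C u * f).Monic := by
    rw [Monic, ← coeff_natDegree, natDegree_C_mul_of_mul_ne_zero (by rw [hu]; exact one_ne_zero),
      coeff_C_mul]
    exact hu
  refine ⟨C u * (p /ₘ (C u * f)), p %ₘ (C u * f), ?_, ?_⟩
  · conv_lhs => rw [← modByMonic_add_div p (C u * f)]
    ring
  · refine (degree_modByMonic_lt p hmon).trans_le ?_
    exact degree_le_of_natDegree_le (natDegree_C_mul_le u f)

theorem degree_lt_of_mul_degree_lt {R : Type*} [CommRing R] [IsDomain R] {f p : R[X]} {n : ℕ}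
    (hf : f ≠ 0) (h : (f * p).degree < ((f.natDegree + n : ℕ) : WithBot ℕ)) :
    p.degree < n := by
  by_cases hp : p = 0
  · rw [hp, degree_zero]; exact WithBot.bot_lt_coe n
  rw [degree_mul, degree_eq_natDegree hf, degree_eq_natDegree hp] at h
  rw [degree_eq_natDegree hp]
  norm_cast at h ⊢
  omega

variable {F : Type*} [Field F]

/-- The algebra `F[s, z] / (f, g, (s - c)ᵉ)`, where `e` is the multiplicity of `c` as a root of the
resultant of `f` and `g` with respect to `z`, has dimension `e`. -/
theorem finrank_quotient_eq_rootMultiplicity_resultant {f g : F[X][X]}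
    (hf : IsUnit f.leadingCoeff) (hR : resultant f g ≠ 0) (c : F) :
    Module.Finite F (F[X][X] ⧸ (Ideal.span {f, g,
        C ((X - C c) ^ rootMultiplicity c (resultant f g))} : Ideal F[X][X])) ∧
    finrank F (F[X][X] ⧸ (Ideal.span {f, g,
        C ((X - C c) ^ rootMultiplicity c (resultant f g))} : Ideal F[X][X])) =
      rootMultiplicity c (resultant f g) := by
  set e := rootMultiplicity c (resultant f g) with he
  set I : Ideal F[X][X] := Ideal.span {f, g, C ((X - C c) ^ e)} with hI
  set m := f.natDegree with hm
  set n := g.natDegree with hn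
  have hf0 : f ≠ 0 := by rintro rfl; simp at hf
  have hfI : f ∈ I := Ideal.subset_span (by simp)
  have hgI : g ∈ I := Ideal.subset_span (by simp)
  have hπI : C ((X - C c) ^ e) ∈ I := Ideal.subset_span (by simp)
  have hdet : (LinearMap.toMatrix
      (((degreeLT.basis F[X] m).prod (degreeLT.basis F[X] n)).reindex finSumFinEquiv)
      (degreeLT.basis F[X] (m + n)) (sylvesterMap f g le_rfl le_rfl)).det = resultant f g := by
    rw [toMatrix_sylvesterMap']; rfl
  let ψ : degreeLT F[X] (m + n) →ₗ[F[X]] (F[X][X] ⧸ I) :=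
    (Ideal.Quotient.mkₐ F[X] I).toLinearMap ∘ₗ (degreeLT F[X] (m + n)).subtype
  have hψ0 : ∀ x, ψ x = 0 ↔ (x : F[X][X]) ∈ I := fun x => Ideal.Quotient.eq_zero_iff_mem
  -- Remainders modulo `f` already represent every class, so the bound `m + n` loses nothing.
  have hψ : Function.Surjective ψ := by
    intro w
    obtain ⟨p, rfl⟩ := Ideal.Quotient.mk_surjective w
    obtain ⟨q, r, rfl, hr⟩ := exists_eq_mul_add_of_isUnit_leadingCoeff hf p
    refine ⟨⟨r, mem_degreeLT.2 (hr.trans_le (by exact_mod_cast Nat.le_add_right m n))⟩, ?_⟩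
    change Ideal.Quotient.mk I r = Ideal.Quotient.mk I (f * q + r)
    rw [Ideal.Quotient.eq]
    rw [sub_add_cancel_right]
    exact I.neg_mem (I.mul_mem_right _ hfI)
  have := finrank_eq_rootMultiplicity_det _ _ (sylvesterMap f g le_rfl le_rfl)
    (by rw [hdet]; exact hR) c ψ hψ ?_
  · rw [hdet] at this
    exact this
  rw [hdet, ← he]
  intro x
  rw [hψ0]
  constructor
  · intro hx
    rw [hI, Ideal.mem_span_insert] at hx
    obtain ⟨α, y, hy, hxy⟩ := hx
    obtain ⟨β, γ, rfl⟩ := Ideal.mem_span_pair.1 hy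
    -- Reduce the coefficients of `g` and of the power of `X - c` modulo `f`, moving the quotients
    -- into the coefficient of `f`. Every other term then has degree below `m + n`, which forces the
    -- coefficient of `f` to have degree below `n`, so it lies in the source of the Sylvester map.
    obtain ⟨q₁, β', hβ, hβd⟩ := exists_eq_mul_add_of_isUnit_leadingCoeff hf β
    obtain ⟨q₂, γ', hγ, hγd⟩ := exists_eq_mul_add_of_isUnit_leadingCoeff hf γ
    have hγ'mem : γ' ∈ degreeLT F[X] (m + n) :=
      mem_degreeLT.2 (hγd.trans_le (by exact_mod_cast Nat.le_add_right m n))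
    set π : F[X] := (X - C c) ^ e with hπ
    have hx' : (x : F[X][X]) - (g * β' + C π * γ') =
        f * (α + q₁ * g + q₂ * C π) := by
      rw [hxy, hβ, hγ]; ring
    have hg' : g * β' ∈ degreeLT F[X] (m + n) := by
      by_cases hb : β' = 0
      · simp [hb]
      by_cases hg0 : g = 0
      · simp [hg0]
      rw [mem_degreeLT, degree_mul, degree_eq_natDegree hg0, degree_eq_natDegree hb]
      rw [degree_eq_natDegree hb] at hβd
      norm_cast at hβd ⊢
      omega
    have hπ' : C π * γ' ∈ degreeLT F[X] (m + n) := by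
      rw [← smul_eq_C_mul]
      exact Submodule.smul_mem _ _ hγ'mem
    have hdeg : (f * (α + q₁ * g + q₂ * C π)).degree < ((m + n : ℕ) : WithBot ℕ) := by
      rw [← hx', ← mem_degreeLT]
      exact Submodule.sub_mem _ x.2 (Submodule.add_mem _ hg' hπ')
    refine ⟨(⟨β', mem_degreeLT.2 hβd⟩,
      ⟨α + q₁ * g + q₂ * C π, mem_degreeLT.2 (degree_lt_of_mul_degree_lt hf0 hdeg)⟩),
      ⟨γ', hγ'mem⟩, ?_⟩
    apply Subtype.ext
    simp only [sylvesterMap_apply_coe, Submodule.coe_add, Submodule.coe_smul, smul_eq_C_mul]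
    rw [← hx']; ring
  · rintro ⟨y, z, rfl⟩
    simp only [sylvesterMap_apply_coe, Submodule.coe_add, Submodule.coe_smul, smul_eq_C_mul]
    exact I.add_mem (I.add_mem (I.mul_mem_right _ hfI) (I.mul_mem_right _ hgI))
      (I.mul_mem_right _ hπI)

end Resultant

end BaseLocus

namespace BaseLocus

open Polynomial Module

/-! ### Finite quotients of the plane's coordinate ring and their points -/

section PointsOfQuotient

universe u

variable {F : Type u} [Field F]

theorem finrank_pi_algebra {ι : Type*} [Fintype ι] (A : ι → Type*) [∀ i, CommRing (A i)]
    [∀ i, Algebra F (A i)] [∀ i, Module.Finite F (A i)] :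
    finrank F (∀ i, A i) = ∑ i, finrank F (A i) :=
  finrank_pi_fintype F

theorem pointIdeal_injective : Function.Injective (pointIdeal : (Fin 2 → F) → _) := by
  intro a b hab
  funext i
  have h : (MvPolynomial.X i - MvPolynomial.C (a i)) ∈ pointIdeal a := by
    simp [pointIdeal, RingHom.mem_ker]
  rw [hab] at h
  simpa [pointIdeal, RingHom.mem_ker, sub_eq_zero, eq_comm] using h

variable (I : Ideal (MvPolynomial (Fin 2) F))

/-- The maximal ideal of the quotient by `I` that corresponds to a zero `a` of `I`. -/
def pointSpectrum (a : Fin 2 → F) (ha : I ≤ pointIdeal a) :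
    MaximalSpectrum (MvPolynomial (Fin 2) F ⧸ I) where
  asIdeal := RingHom.ker (Ideal.Quotient.lift I (MvPolynomial.eval a) ha)
  isMaximal := RingHom.ker_isMaximal_of_surjective _ fun x =>
    ⟨Ideal.Quotient.mk I (MvPolynomial.C x), MvPolynomial.eval_C x⟩

theorem comap_pointSpectrum (a : Fin 2 → F) (ha : I ≤ pointIdeal a) :
    (pointSpectrum I a ha).asIdeal.comap (Ideal.Quotient.mk I) = pointIdeal a := by
  ext x
  exact Iff.rfl

/-- This is the Nullstellensatz, applied to the preimage of `J` in the polynomial ring. -/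
theorem exists_pointSpectrum_eq [IsAlgClosed F]
    (J : MaximalSpectrum (MvPolynomial (Fin 2) F ⧸ I)) : ∃ a ha, pointSpectrum I a ha = J := by
  have hJ := J.isMaximal
  have hmax : (J.asIdeal.comap (Ideal.Quotient.mk I)).IsMaximal :=
    Ideal.comap_isMaximal_of_surjective _ Ideal.Quotient.mk_surjective
  obtain ⟨a, ha⟩ := MvPolynomial.isMaximal_iff_eq_vanishingIdeal_singleton.1 hmax
  have hp : J.asIdeal.comap (Ideal.Quotient.mk I) = pointIdeal a := by
    rw [ha]
    ext x
    rw [MvPolynomial.mem_vanishingIdeal_singleton_iff, RingHom.mem_ker,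
      MvPolynomial.aeval_eq_eval]
  have hI : I ≤ pointIdeal a := by
    rw [← hp]
    intro x hx
    rw [Ideal.mem_comap, Ideal.Quotient.eq_zero_iff_mem.2 hx]
    exact J.asIdeal.zero_mem
  refine ⟨a, hI, MaximalSpectrum.ext ?_⟩
  apply Ideal.comap_injective_of_surjective _ Ideal.Quotient.mk_surjective
  rw [comap_pointSpectrum, hp]

/-- The local ring at a zero `a` of `I`, modulo `I`, is a localization of the quotient by `I`. -/
def localRingQuotientEquiv (a : Fin 2 → F) (ha : I ≤ pointIdeal a) :
    Localization.AtPrime (pointSpectrum I a ha).asIdeal ≃ₗ[F]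
      (LocalRingAt a ⧸ I.map (algebraMap (MvPolynomial (Fin 2) F) (LocalRingAt a))) := by
  -- The denominators in the quotient are the images of those upstairs, so localizing and dividing
  -- by `I` commute.
  have h : (pointSpectrum I a ha).asIdeal.primeCompl = Algebra.algebraMapSubmonoid
      (MvPolynomial (Fin 2) F ⧸ I) (pointIdeal a).primeCompl := by
    ext x
    obtain ⟨x, rfl⟩ := Ideal.Quotient.mk_surjective x
    simp only [Ideal.mem_primeCompl_iff, Algebra.algebraMapSubmonoid, Submonoid.mem_map]
    rw [← Ideal.mem_comap, comap_pointSpectrum]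
    constructor
    · intro hx
      exact ⟨x, hx, rfl⟩
    · rintro ⟨y, hy, hyx⟩ hx
      apply hy
      rw [← comap_pointSpectrum I a ha, Ideal.mem_comap] at hx ⊢
      exact hyx ▸ hx
  have : IsLocalization (pointSpectrum I a ha).asIdeal.primeCompl
      (LocalRingAt a ⧸ I.map (algebraMap (MvPolynomial (Fin 2) F) (LocalRingAt a))) := by
    rw [h]; infer_instance
  have : @IsScalarTower F (MvPolynomial (Fin 2) F ⧸ I)
      (LocalRingAt a ⧸ I.map (algebraMap (MvPolynomial (Fin 2) F) (LocalRingAt a)))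
      Algebra.toSMul Algebra.toSMul Algebra.toSMul := by
    refine IsScalarTower.of_algebraMap_eq fun r => ?_
    exact congrArg
      (Ideal.Quotient.mk (I.map (algebraMap (MvPolynomial (Fin 2) F) (LocalRingAt a))))
      (IsScalarTower.algebraMap_apply F (MvPolynomial (Fin 2) F) (LocalRingAt a) r)
  exact ((IsLocalization.algEquiv (pointSpectrum I a ha).asIdeal.primeCompl
    (Localization.AtPrime (pointSpectrum I a ha).asIdeal)
    (LocalRingAt a ⧸ I.map (algebraMap (MvPolynomial (Fin 2) F) (LocalRingAt a)))).restrictScalars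
      F).toLinearEquiv

/-- The dimension of a finite-dimensional quotient of the coordinate ring of the affine plane is the
sum of the dimensions of the local rings at its points. -/
theorem sum_finrank_localRing [IsAlgClosed F] [Module.Finite F (MvPolynomial (Fin 2) F ⧸ I)]
    (Z : Finset (Fin 2 → F)) (hZ : ∀ a, a ∈ Z ↔ I ≤ pointIdeal a) :
    (∀ a ∈ Z, Module.Finite F
      (LocalRingAt a ⧸ I.map (algebraMap (MvPolynomial (Fin 2) F) (LocalRingAt a)))) ∧
    ∑ a ∈ Z, finrank F
      (LocalRingAt a ⧸ I.map (algebraMap (MvPolynomial (Fin 2) F) (LocalRingAt a))) =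
      finrank F (MvPolynomial (Fin 2) F ⧸ I) := by
  have : IsArtinianRing (MvPolynomial (Fin 2) F ⧸ I) := IsArtinianRing.of_finite F _
  let e : Z → MaximalSpectrum (MvPolynomial (Fin 2) F ⧸ I) :=
    fun a => pointSpectrum I a.1 ((hZ _).1 a.2)
  have he : Function.Bijective e := by
    constructor
    · intro a b hab
      apply Subtype.ext
      apply pointIdeal_injective
      rw [← comap_pointSpectrum I a.1 ((hZ _).1 a.2), ← comap_pointSpectrum I b.1 ((hZ _).1 b.2)]
      exact congrArg (fun J => Ideal.comap (Ideal.Quotient.mk I) J.asIdeal) hab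
    · intro J
      obtain ⟨a, ha, h⟩ := exists_pointSpectrum_eq I J
      exact ⟨⟨a, (hZ a).2 ha⟩, h⟩
  -- An Artinian ring is the product of its localizations at maximal ideals, and these correspond to
  -- the points of `Z`.
  let E := ((MaximalSpectrum.toPiLocalizationEquiv
    (MvPolynomial (Fin 2) F ⧸ I)).restrictScalars F).toLinearEquiv
  have hfinJ : ∀ J : MaximalSpectrum (MvPolynomial (Fin 2) F ⧸ I),
      Module.Finite F (Localization.AtPrime J.asIdeal) := by
    intro J
    refine Module.Finite.of_surjective ((LinearMap.proj J).comp E.toLinearMap) ?_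
    exact (Function.surjective_eval J).comp E.surjective
  have : Fintype (MaximalSpectrum (MvPolynomial (Fin 2) F ⧸ I)) := Fintype.ofFinite _
  constructor
  · intro a ha
    have := hfinJ (e ⟨a, ha⟩)
    exact Module.Finite.equiv (localRingQuotientEquiv I a ((hZ a).1 ha))
  · rw [E.finrank_eq.trans (finrank_pi_algebra
        (fun J : MaximalSpectrum (MvPolynomial (Fin 2) F ⧸ I) => Localization.AtPrime J.asIdeal)),
      ← (Equiv.ofBijective e he).sum_comp, ← Finset.sum_coe_sort]
    exact Finset.sum_congr rfl fun a _ =>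
      (localRingQuotientEquiv I a.1 ((hZ a.1).1 a.2)).finrank_eq.symm

end PointsOfQuotient

end BaseLocus

namespace BaseLocus

open Polynomial Module

/-! ### Root multiplicity of the resultant as a sum of intersection multiplicities -/

section LocalIntersection

universe u

variable {F : Type u} [Field F]

/-- This is the Bézout identity for the Sylvester matrix. It requires a positive degree; if both
degrees are zero, `f` itself is a unit. -/
theorem C_resultant_mem_span {R : Type*} [CommRing R] {f g : R[X]}
    (hf : IsUnit f.leadingCoeff) : C (resultant f g) ∈ Ideal.span {f, g} := by
  by_cases h : f.natDegree ≠ 0 ∨ g.natDegree ≠ 0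
  · obtain ⟨p, q, -, -, hpq⟩ := exists_mul_add_mul_eq_C_resultant f g le_rfl le_rfl h
    exact Ideal.mem_span_pair.2 ⟨p, q, by rw [← hpq]; ring⟩
  · push Not at h
    have hu : IsUnit f := by
      rw [natDegree_eq_zero.1 h.1 |>.choose_spec.symm] at hf ⊢
      rw [leadingCoeff_C] at hf
      exact hf.map C
    rw [Ideal.eq_top_of_isUnit_mem _ (Ideal.subset_span (by simp)) hu]
    trivial

/-- Fixes the convention for coordinates: the inner variable `s` is coordinate `0`, the outer
variable `z` is coordinate `1`. -/
theorem eval_equivMvPolynomial (a : Fin 2 → F) (f : F[X][X]) :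
    MvPolynomial.eval a (Polynomial.Bivariate.equivMvPolynomial F f) =
      (f.map (evalRingHom (a 0))).eval (a 1) := by
  have h : (MvPolynomial.eval a).comp
      (Polynomial.Bivariate.equivMvPolynomial F : F[X][X] →+* MvPolynomial (Fin 2) F) =
      (evalRingHom (a 1)).comp (mapRingHom (evalRingHom (a 0))) := by
    ext <;> simp
  exact congrArg (fun φ : F[X][X] →+* F => φ f) h

/-- The local ring of the plane at `a`, modulo `f` and `g`, does not change when a power of `s - c`
that divides the resultant up to a unit at `a` is adjoined. -/
theorem map_span_eq_span_pair {f g : F[X][X]} (hf : IsUnit f.leadingCoeff)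
    (hR : resultant f g ≠ 0) (a : Fin 2 → F) :
    ((Ideal.span {f, g, C ((X - C (a 0)) ^ rootMultiplicity (a 0) (resultant f g))}).map
      (Polynomial.Bivariate.equivMvPolynomial F : F[X][X] →+* MvPolynomial (Fin 2) F)).map
        (algebraMap (MvPolynomial (Fin 2) F) (LocalRingAt a)) =
    Ideal.span {algebraMap (MvPolynomial (Fin 2) F) (LocalRingAt a)
        (Polynomial.Bivariate.equivMvPolynomial F f),
      algebraMap (MvPolynomial (Fin 2) F) (LocalRingAt a)
        (Polynomial.Bivariate.equivMvPolynomial F g)} := by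
  set ε := (Polynomial.Bivariate.equivMvPolynomial F : F[X][X] →+* MvPolynomial (Fin 2) F)
  set lo := algebraMap (MvPolynomial (Fin 2) F) (LocalRingAt a)
  set π := (X - C (a 0)) ^ rootMultiplicity (a 0) (resultant f g) with hπ
  rw [Ideal.map_map, Ideal.map_span]
  apply le_antisymm
  · rw [Ideal.span_le]
    rintro _ ⟨p, hp, rfl⟩
    -- The resultant is `(s - c)ᵉ h` with `h(c) ≠ 0`. The factor `h` is a unit in the local ring, so
    -- `(s - c)ᵉ` inherits membership in `(f, g)` from the resultant.
    obtain ⟨h, hRh, hnd⟩ := exists_eq_pow_rootMultiplicity_mul_and_not_dvd _ hR (a 0)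
    have hmem := Ideal.mem_map_of_mem (lo.comp ε) (C_resultant_mem_span (g := g) hf)
    rw [Ideal.map_span, Set.image_pair] at hmem
    have hunit : IsUnit ((lo.comp ε) (C h)) := by
      refine IsLocalization.map_units (LocalRingAt a) (⟨ε (C h), ?_⟩ : (pointIdeal a).primeCompl)
      rw [Ideal.mem_primeCompl_iff, RingHom.mem_ker]
      have h1 := eval_equivMvPolynomial a (C h)
      rw [map_C, eval_C, coe_evalRingHom] at h1
      intro h2
      exact hnd (dvd_iff_isRoot.2 (h1.symm.trans h2))
    rw [hRh, C_mul, map_mul] at hmem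
    have hmem' := (Ideal.mul_unit_mem_iff_mem _ hunit).1 hmem
    rcases hp with rfl | rfl | rfl
    · exact Ideal.subset_span (by left; rfl)
    · exact Ideal.subset_span (by right; rfl)
    · exact hmem'
  · apply Ideal.span_mono
    rintro _ (rfl | rfl)
    · exact ⟨f, by simp, rfl⟩
    · exact ⟨g, by simp, rfl⟩

theorem affineMult_eq_finrank {f g : MvPolynomial (Fin 2) F} {a : Fin 2 → F}
    {J : Ideal (LocalRingAt a)}
    (hJ : Ideal.span {algebraMap (MvPolynomial (Fin 2) F) (LocalRingAt a) f,
      algebraMap (MvPolynomial (Fin 2) F) (LocalRingAt a) g} = J)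
    [Module.Finite F (LocalRingAt a ⧸ J)] :
    affineMult f g a = (finrank F (LocalRingAt a ⧸ J) : ℕ∞) := by
  subst hJ
  rw [affineMult, ← finrank_eq_rank, Cardinal.toENat_nat]

/-- The multiplicity of a root of the resultant is the sum of the intersection multiplicities over
the points above it. -/
theorem sum_affineMult_eq_rootMultiplicity_resultant [IsAlgClosed F] {f g : F[X][X]}
    (hf : IsUnit f.leadingCoeff) (hR : resultant f g ≠ 0) (c : F) (Γ : Finset F)
    (hΓ : ∀ z, z ∈ Γ ↔ (f.map (evalRingHom c)).eval z = 0 ∧ (g.map (evalRingHom c)).eval z = 0) :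
    ∑ z ∈ Γ, affineMult (Polynomial.Bivariate.equivMvPolynomial F f)
      (Polynomial.Bivariate.equivMvPolynomial F g) ![c, z] =
      (rootMultiplicity c (resultant f g) : ℕ∞) := by
  classical
  let ε := Polynomial.Bivariate.equivMvPolynomial F
  set e := rootMultiplicity c (resultant f g) with he
  set I₀ : Ideal F[X][X] := Ideal.span {f, g, C ((X - C c) ^ e)} with hI₀
  set I : Ideal (MvPolynomial (Fin 2) F) := I₀.map (ε : F[X][X] →+* MvPolynomial (Fin 2) F)
    with hI
  obtain ⟨hfin, hrank⟩ := finrank_quotient_eq_rootMultiplicity_resultant hf hR c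
  let E : (F[X][X] ⧸ I₀) ≃ₐ[F] (MvPolynomial (Fin 2) F ⧸ I) := Ideal.quotientEquivAlg I₀ I ε rfl
  have hfinI : Module.Finite F (MvPolynomial (Fin 2) F ⧸ I) :=
    Module.Finite.equiv E.toLinearEquiv
  have hle : ∀ a : Fin 2 → F, I ≤ pointIdeal a ↔
      (f.map (evalRingHom (a 0))).eval (a 1) = 0 ∧ (g.map (evalRingHom (a 0))).eval (a 1) = 0 ∧
        (a 0 - c) ^ e = 0 := by
    intro a
    rw [hI, Ideal.map_le_iff_le_comap, hI₀, Ideal.span_le, Set.insert_subset_iff,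
      Set.insert_subset_iff, Set.singleton_subset_iff]
    simp only [SetLike.mem_coe, Ideal.mem_comap, RingHom.mem_ker]
    have h := eval_equivMvPolynomial a
    have h3 := h (C ((X - C c) ^ e))
    simp only [Polynomial.map_C, coe_evalRingHom, eval_C, eval_pow, eval_sub, eval_X] at h3
    rw [← h f, ← h g, ← h3]
    rfl
  let Z : Finset (Fin 2 → F) := Γ.image fun z => ![c, z]
  have hZ : ∀ a, a ∈ Z ↔ I ≤ pointIdeal a := by
    intro a
    rw [hle, Finset.mem_image]
    constructor
    · rintro ⟨z, hz, rfl⟩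
      obtain ⟨h1, h2⟩ := (hΓ z).1 hz
      refine ⟨h1, h2, ?_⟩
      -- For `e = 0` the ideal `I` would be everything and have no zeros. A common zero above `c`
      -- excludes this, since the resultant then vanishes at `c`.
      have hne : e ≠ 0 := by
        obtain ⟨p, q, hpq⟩ := Ideal.mem_span_pair.1 (C_resultant_mem_span (g := g) hf)
        have h4 := congrArg (fun p => (p.map (evalRingHom c)).eval z) hpq
        simp only [Polynomial.map_add, Polynomial.map_mul, eval_add, eval_mul, h1, h2, mul_zero,
          add_zero, map_C, eval_C, coe_evalRingHom] at h4
        exact ((rootMultiplicity_pos hR).2 h4.symm).ne'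
      simp [hne]
    · rintro ⟨h1, h2, h3⟩
      have hac : a 0 = c := sub_eq_zero.1 (eq_zero_of_pow_eq_zero h3)
      rw [hac] at h1 h2
      refine ⟨a 1, (hΓ _).2 ⟨h1, h2⟩, ?_⟩
      funext i
      fin_cases i
      · exact hac.symm
      · rfl
  obtain ⟨hfinloc, hsum⟩ := sum_finrank_localRing I Z hZ
  rw [← E.toLinearEquiv.finrank_eq, hrank] at hsum
  rw [he, ← hsum, Nat.cast_sum, Finset.sum_image (fun x _ y _ hxy => by simpa using congrFun hxy 1)]
  refine Finset.sum_congr rfl fun z hz => ?_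
  have hspan := map_span_eq_span_pair hf hR ![c, z]
  have := hfinloc ![c, z] (Finset.mem_image_of_mem _ hz)
  exact affineMult_eq_finrank hspan.symm

end LocalIntersection

end BaseLocus

namespace BaseLocus

open Polynomial

/-! ### Independent coefficients and nonvanishing of the resultant -/

section Independence

/-- If a linear combination of polynomials with indeterminate coefficients `xᵢ`, and the same
combination with further indeterminate coefficients `yᵢ`, have a common root, then it is a common
root of all the polynomials. -/
theorem aeval_eq_zero_of_sum_eq_zero {k Ω : Type*} [Field k] [Field Ω] [Algebra k Ω]
    {x y : Fin 4 → Ω} (h : AlgebraicIndependent k (Sum.elim x y)) (q : Fin 4 → k[X])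
    (hq : ∃ i, q i ≠ 0) (z : Ω) (h1 : ∑ i, x i * aeval z (q i) = 0)
    (h2 : ∑ i, y i * aeval z (q i) = 0) (i : Fin 4) : aeval z (q i) = 0 := by
  obtain ⟨hy, hx⟩ := AlgebraicIndependent.sumElim_iff.1 h
  set A₀ := Algebra.adjoin k (Set.range y) with hA₀
  let Y : Fin 4 → A₀ := fun i => ⟨y i, Algebra.subset_adjoin ⟨i, rfl⟩⟩
  let G : A₀[X] := ∑ i, C (Y i) * (q i).map (algebraMap k A₀)
  -- Linear independence of the `yᵢ` over `k` keeps `G = ∑ yᵢ qᵢ` nonzero; as `G(z) = 0`, the point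
  -- `z` is algebraic over `k[y]`.
  have hG : G ≠ 0 := by
    intro hG
    obtain ⟨i, hi⟩ := hq
    apply hi
    ext j
    have h3 : ∑ i, (q i).coeff j • y i = 0 := by
      have h4 := congrArg (fun p : A₀[X] => ((p.coeff j : A₀) : Ω)) hG
      simp only [G, finsetSum_coeff, coeff_C_mul, coeff_map, coeff_zero,
        AddSubmonoidClass.coe_finsetSum, MulMemClass.coe_mul, ZeroMemClass.coe_zero] at h4
      rw [← h4]
      refine Finset.sum_congr rfl fun i _ => ?_
      rw [Algebra.smul_def, mul_comm]
      rfl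
    exact Fintype.linearIndependent_iff.1 hy.linearIndependent _ h3 i
  have hz : IsAlgebraic A₀ z := by
    refine ⟨G, hG, ?_⟩
    rw [← h2]
    simp only [G, map_sum, map_mul, aeval_C, aeval_map_algebraMap]
    rfl
  -- The `xᵢ` stay independent over the algebraic closure of `k[y]` in `Ω`, which contains all
  -- values `qᵢ(z)`. So the relation `∑ xᵢ qᵢ(z) = 0` is trivial.
  have hxE := hx.subalgebraAlgebraicClosure
  have hmem : ∀ i, IsAlgebraic A₀ (aeval z (q i)) := by
    intro i
    have h4 : aeval z (q i) = aeval z ((q i).map (algebraMap k A₀)) := by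
      rw [aeval_map_algebraMap]
    rw [h4]
    exact Algebra.isAlgebraic_adjoin_singleton_iff.2 hz _ (aeval_mem_adjoin_singleton _ _)
  have h5 := Fintype.linearIndependent_iff.1 hxE.linearIndependent
    (fun i => (⟨aeval z (q i), hmem i⟩ : Subalgebra.algebraicClosure A₀ Ω)) (by
      rw [← h1]
      refine Finset.sum_congr rfl fun i _ => ?_
      rw [Algebra.smul_def, mul_comm]
      rfl) i
  exact congrArg Subtype.val h5

/-- The linear combination of the polynomials `Pᵢ` with the coefficients `xᵢ`. -/
def genericComb {A B : Type*} [CommRing A] [CommRing B] (φ : A →+* B) (x : Fin 4 → B)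
    (P : Fin 4 → A[X]) : B[X] :=
  ∑ i, C (x i) * (P i).map φ

theorem map_genericComb {A B B' : Type*} [CommRing A] [CommRing B] [CommRing B'] (φ : A →+* B)
    (ψ : B →+* B') (x : Fin 4 → B) (P : Fin 4 → A[X]) :
    (genericComb φ x P).map ψ = genericComb (ψ.comp φ) (fun i => ψ (x i)) P := by
  simp [genericComb, Polynomial.map_sum, Polynomial.map_map]

theorem eval_genericComb {A B : Type*} [CommRing A] [CommRing B] (φ : A →+* B) (x : Fin 4 → B)
    (P : Fin 4 → A[X]) (z : B) :
    (genericComb φ x P).eval z = ∑ i, x i * (P i).eval₂ φ z := by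
  simp [genericComb, eval_finsetSum, eval_map]

/-- A vanishing resultant gives a common root `z` in `Ω`, which by independence is a root of every
`P i`. The unit leading coefficient makes `z` integral over `A`; as `A` is integrally closed, the
minimal polynomial of `z` over `A` is a nonunit dividing all `P i`. -/
theorem resultant_genericComb_ne_zero_aux {A k Ω : Type*} [CommRing A] [IsDomain A]
    [IsIntegrallyClosed A] [Field k] [Field Ω] [IsAlgClosed Ω] [Algebra A k] [Algebra k Ω]
    [Algebra A Ω] [IsScalarTower A k Ω] (hk : Function.Injective (algebraMap A k))
    (κ : MvPolynomial XY A →+* Ω) (hκ : Function.Injective κ)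
    (hκC : κ.comp MvPolynomial.C = algebraMap A Ω)
    (hind : AlgebraicIndependent k
      (Sum.elim (fun i => κ (.X (.inl i))) (fun i => κ (.X (.inr i))) : XY → Ω))
    (P : Fin 4 → A[X]) (hlc : ∃ i, IsUnit (P i).leadingCoeff)
    (hgcd : ∀ d, (∀ i, d ∣ P i) → IsUnit d) :
    resultant
      (genericComb (MvPolynomial.C : A →+* MvPolynomial XY A) (fun i => .X (.inl i)) P)
      (genericComb (MvPolynomial.C : A →+* MvPolynomial XY A) (fun i => .X (.inr i)) P) ≠ 0 := by
  intro hres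
  have : FaithfulSMul A k := (faithfulSMul_iff_algebraMap_injective A k).2 hk
  have : Module.IsTorsionFree A Ω := by
    have h0 : Function.Injective (algebraMap A Ω) := by
      rw [IsScalarTower.algebraMap_eq A k Ω]
      exact (algebraMap k Ω).injective.comp hk
    have := (faithfulSMul_iff_algebraMap_injective A Ω).2 h0
    infer_instance
  have h1 := congrArg κ hres
  rw [← resultant_map_map, map_zero, ← natDegree_map_eq_of_injective hκ,
    ← natDegree_map_eq_of_injective hκ (genericComb _ (fun i => .X (.inr i)) P),
    resultant_eq_zero_iff] at h1
  have h2 := h1.2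
  rw [isCoprime_iff_aeval_ne_zero_of_isAlgClosed (k := Ω) Ω] at h2
  push Not at h2
  obtain ⟨z, hz1, hz2⟩ := h2
  have hroot : ∀ i, aeval z (P i) = 0 := by
    intro i
    have h3 := aeval_eq_zero_of_sum_eq_zero hind (fun i => (P i).map (algebraMap A k)) ?_ z ?_ ?_ i
    · rwa [aeval_map_algebraMap] at h3
    · obtain ⟨j, hj⟩ := hlc
      refine ⟨j, fun h0 => ?_⟩
      rw [Polynomial.map_eq_zero_iff (hk)] at h0
      rw [h0] at hj
      simp at hj
    · rw [coe_aeval_eq_eval, map_genericComb, eval_genericComb, hκC] at hz1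
      simp only [aeval_map_algebraMap]
      exact hz1
    · rw [coe_aeval_eq_eval, map_genericComb, eval_genericComb, hκC] at hz2
      simp only [aeval_map_algebraMap]
      exact hz2
  obtain ⟨j, hj⟩ := hlc
  have hint : IsIntegral A z := by
    obtain ⟨u, hu⟩ := hj.exists_left_inv
    refine ⟨C u * P j, ?_, ?_⟩
    · rw [Monic, ← coeff_natDegree,
        natDegree_C_mul_of_mul_ne_zero (by rw [hu]; exact one_ne_zero), coeff_C_mul]
      exact hu
    · rw [← aeval_def, map_mul, hroot, mul_zero]
  exact minpoly.not_isUnit A z (hgcd _ fun i => minpoly.isIntegrallyClosed_dvd hint (hroot i))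

theorem algebraMap_algebraicClosure_injective (B : Type*) [CommRing B] [IsDomain B] :
    Function.Injective (algebraMap B (AlgebraicClosure (FractionRing B))) := by
  rw [IsScalarTower.algebraMap_eq B (FractionRing B)]
  exact (algebraMap (FractionRing B) (AlgebraicClosure (FractionRing B))).injective.comp
    (IsFractionRing.injective B (FractionRing B))

theorem algebraMap_comp_C (k : Type*) [Field k] {Ω : Type*} [Field Ω]
    [Algebra k Ω] [Algebra (MvPolynomial XY k) Ω] [IsScalarTower k (MvPolynomial XY k) Ω] :
    (algebraMap (MvPolynomial XY k) Ω).comp MvPolynomial.C = algebraMap k Ω :=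
  (IsScalarTower.algebraMap_eq k (MvPolynomial XY k) Ω).symm

theorem algebraicIndependent_XY (k : Type*) [Field k] {Ω : Type*} [Field Ω]
    [Algebra k Ω] [Algebra (MvPolynomial XY k) Ω] [IsScalarTower k (MvPolynomial XY k) Ω]
    (h : Function.Injective (algebraMap (MvPolynomial XY k) Ω)) :
    AlgebraicIndependent k
      (Sum.elim (fun i => algebraMap (MvPolynomial XY k) Ω (.X (.inl i)))
        (fun i => algebraMap (MvPolynomial XY k) Ω (.X (.inr i))) : XY → Ω) := by
  have h0 := (MvPolynomial.algebraicIndependent_X XY k).map'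
    (f := IsScalarTower.toAlgHom k (MvPolynomial XY k) Ω) h
  convert h0 using 1
  funext i
  rcases i with i | i <;> rfl

/-- The resultant of two combinations, with independent indeterminate coefficients, of polynomials
without a common factor is not zero. -/
theorem resultant_genericComb_ne_zero {A : Type*} [CommRing A] [IsDomain A]
    [IsIntegrallyClosed A] (P : Fin 4 → A[X]) (hlc : ∃ i, IsUnit (P i).leadingCoeff)
    (hgcd : ∀ d, (∀ i, d ∣ P i) → IsUnit d) :
    resultant
      (genericComb (MvPolynomial.C : A →+* MvPolynomial XY A) (fun i => .X (.inl i)) P)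
      (genericComb (MvPolynomial.C : A →+* MvPolynomial XY A) (fun i => .X (.inr i)) P) ≠ 0 := by
  have hB := algebraMap_algebraicClosure_injective (MvPolynomial XY (FractionRing A))
  refine resultant_genericComb_ne_zero_aux (k := FractionRing A)
    (Ω := AlgebraicClosure (FractionRing (MvPolynomial XY (FractionRing A))))
    (IsFractionRing.injective A _)
    ((algebraMap _ _).comp (MvPolynomial.map (algebraMap A (FractionRing A))))
    (hB.comp (MvPolynomial.map_injective _ (IsFractionRing.injective A _))) ?_ ?_ P hlc hgcd
  · ext a
    simp only [RingHom.comp_apply, MvPolynomial.map_C]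
    rw [IsScalarTower.algebraMap_apply A (FractionRing A)
      (AlgebraicClosure (FractionRing (MvPolynomial XY (FractionRing A)))),
      ← algebraMap_comp_C (FractionRing A), RingHom.comp_apply]
  · simp only [RingHom.comp_apply, MvPolynomial.map_X]
    exact algebraicIndependent_XY _ hB

end Independence

end BaseLocus

namespace BaseLocus

open Polynomial

/-! ### Homogeneity through the scaling `t ↦ λ t` -/

section Homogeneous

universe u

variable {K : Type u} [Field K] {σ : Type*}

/-- The substitution `h(t) ↦ h(λ t)`, where `λ` is a new variable. -/
def scaleHom : MvPolynomial σ K →ₐ[K] (MvPolynomial σ K)[X] :=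
  MvPolynomial.aeval fun i => X * C (MvPolynomial.X i)

theorem scaleHom_monomial (m : σ →₀ ℕ) (a : K) :
    scaleHom (MvPolynomial.monomial m a) = C (MvPolynomial.monomial m a) * X ^ m.degree := by
  rw [scaleHom, MvPolynomial.aeval_monomial, MvPolynomial.monomial_eq, map_mul]
  simp only [mul_pow, Finsupp.prod_mul]
  rw [mul_comm (Finsupp.prod _ _), ← mul_assoc, map_finsuppProd]
  simp only [map_pow]
  congr 1
  rw [Finsupp.degree, Finsupp.prod, Finset.prod_pow_eq_pow_sum]
  rfl

theorem coeff_scaleHom (h : MvPolynomial σ K) (d : ℕ) :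
    (scaleHom h).coeff d = MvPolynomial.homogeneousComponent d h := by
  induction h using MvPolynomial.induction_on' with
  | monomial m a =>
    rw [scaleHom_monomial, coeff_C_mul_X_pow]
    by_cases hd : d = m.degree
    · rw [if_pos hd, hd, MvPolynomial.homogeneousComponent_of_mem
        (MvPolynomial.isHomogeneous_monomial a rfl), if_pos rfl]
    · rw [if_neg hd, MvPolynomial.homogeneousComponent_of_mem
        (MvPolynomial.isHomogeneous_monomial a rfl), if_neg hd]
  | add p q hp hq => rw [map_add, coeff_add, hp, hq, map_add]

/-- Homogeneity becomes an identity under a ring homomorphism, so it can be carried through products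
and resultants. -/
theorem isHomogeneous_iff_scaleHom {h : MvPolynomial σ K} {N : ℕ} :
    h.IsHomogeneous N ↔ scaleHom h = C h * X ^ N := by
  constructor
  · intro hh
    ext1 d
    rw [coeff_scaleHom, coeff_C_mul_X_pow, MvPolynomial.homogeneousComponent_of_mem hh]
  · intro hh
    have h1 := congrArg (fun p => p.coeff N) hh
    simp only [coeff_scaleHom, coeff_C_mul_X_pow, if_true] at h1
    rw [← h1]
    exact MvPolynomial.homogeneousComponent_isHomogeneous N h

theorem scaleHom_ne_zero {h : MvPolynomial σ K} (hh : h ≠ 0) : scaleHom h ≠ 0 := by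
  intro h0
  apply hh
  ext m
  have h1 := congrArg (fun p => p.coeff m.degree) h0
  simp only [coeff_scaleHom, coeff_zero] at h1
  have h2 := congrArg (MvPolynomial.coeff m) h1
  rw [MvPolynomial.coeff_homogeneousComponent, if_pos rfl] at h2
  exact h2

/-- A factor of a nonzero homogeneous polynomial is homogeneous. -/
theorem exists_isHomogeneous_of_mul {f g : MvPolynomial σ K} {N : ℕ} (hfg : f * g ≠ 0)
    (h : (f * g).IsHomogeneous N) :
    (∃ a, f.IsHomogeneous a) ∧ ∃ b, g.IsHomogeneous b := by
  have hf := scaleHom_ne_zero (left_ne_zero_of_mul hfg)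
  have hg := scaleHom_ne_zero (right_ne_zero_of_mul hfg)
  rw [isHomogeneous_iff_scaleHom, map_mul] at h
  -- The highest and the lowest power of `λ` are both additive and both total `N`, so in each factor
  -- they coincide: only one homogeneous component is present.
  have h1 : (scaleHom f).natDegree + (scaleHom g).natDegree = N := by
    rw [← natDegree_mul hf hg, h, natDegree_C_mul_X_pow _ _ hfg]
  have h2 : (scaleHom f).natTrailingDegree + (scaleHom g).natTrailingDegree = N := by
    rw [← natTrailingDegree_mul hf hg, h, natTrailingDegree_mul_X_pow (by simpa using hfg),
      natTrailingDegree_C, zero_add]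
  have h3 := natTrailingDegree_le_natDegree (scaleHom f)
  have h4 := natTrailingDegree_le_natDegree (scaleHom g)
  have key : ∀ p : MvPolynomial σ K, (scaleHom p).natDegree = (scaleHom p).natTrailingDegree →
      p.IsHomogeneous (scaleHom p).natDegree := by
    intro p hp m hm
    have h5 : (scaleHom p).coeff m.degree ≠ 0 := by
      intro h0
      rw [coeff_scaleHom] at h0
      have h6 := congrArg (MvPolynomial.coeff m) h0
      rw [MvPolynomial.coeff_homogeneousComponent, if_pos rfl] at h6
      exact hm h6
    have h7 := le_natDegree_of_ne_zero h5
    have h8 := natTrailingDegree_le_of_ne_zero h5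
    rw [Finsupp.degree_eq_weight_one] at h7 h8
    exact le_antisymm h7 (hp ▸ h8)
  exact ⟨⟨_, key f (by omega)⟩, ⟨_, key g (by omega)⟩⟩

/-! ### Binary forms -/

/-- The affine point `t_l = c` of the projective line, in the chart where the other coordinate
is `1`. -/
def linePoint (l : Fin 2) (c : K) : Fin 2 → K := fun i => if i = l then c else 1

/-- Dehomogenization of binary forms, keeping the variable `t_l`. -/
def lineEval (l : Fin 2) : MvPolynomial (Fin 2) K →ₐ[K] K[X] :=
  MvPolynomial.aeval fun i => if i = l then X else 1

theorem eval_lineEval (l : Fin 2) (c : K) (h : MvPolynomial (Fin 2) K) :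
    (lineEval l h).eval c = MvPolynomial.eval (linePoint l c) h := by
  have : (aeval c : K[X] →ₐ[K] K).comp (lineEval l) = MvPolynomial.aeval (linePoint l c) := by
    apply MvPolynomial.algHom_ext
    intro i
    by_cases hi : i = l <;> simp [lineEval, linePoint, hi]
  exact congrArg (fun φ : MvPolynomial (Fin 2) K →ₐ[K] K => φ h) this

/-- The linear form that vanishes at `linePoint l c`. -/
def pointForm (l : Fin 2) (c : K) : MvPolynomial (Fin 2) K :=
  .X l - .C c * .X (1 - l)

theorem one_sub_ne (l : Fin 2) : 1 - l ≠ l := by fin_cases l <;> decide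

theorem eq_or_eq_one_sub (l i : Fin 2) : i = l ∨ i = 1 - l := by
  fin_cases l <;> fin_cases i <;> decide

theorem not_isUnit_pointForm (l : Fin 2) (c : K) : ¬ IsUnit (pointForm l c) := by
  intro h
  have h1 := h.map (MvPolynomial.eval (linePoint l c))
  simp [pointForm, linePoint, one_sub_ne] at h1

/-- Modulo `pointForm l c` the vector of variables equals `t_{1-l}` times `linePoint l c`, so `h`
becomes `t_{1-l} ^ N` times its value at that point. The map `φ` is this substitution. -/
theorem pointForm_dvd {h : MvPolynomial (Fin 2) K} {N : ℕ} (hh : h.IsHomogeneous N) (l : Fin 2)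
    (c : K) (h0 : MvPolynomial.eval (linePoint l c) h = 0) : pointForm l c ∣ h := by
  let φ : MvPolynomial (Fin 2) K →+* MvPolynomial (Fin 2) K :=
    (eval₂RingHom ((MvPolynomial.C).comp (MvPolynomial.eval (linePoint l c)))
      (MvPolynomial.X (1 - l))).comp scaleHom.toRingHom
  have hφX : ∀ i, φ (.X i) = .C (linePoint l c i) * .X (1 - l) := by
    intro i
    have : scaleHom (MvPolynomial.X i : MvPolynomial (Fin 2) K) = X * C (.X i) :=
      MvPolynomial.aeval_X _ _
    simp [φ, this]
  have hφ : φ h = 0 := by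
    have := isHomogeneous_iff_scaleHom.1 hh
    simp [φ, this, h0]
  rw [← Ideal.mem_span_singleton, ← Ideal.Quotient.eq_zero_iff_mem]
  have hq : (Ideal.Quotient.mk (Ideal.span {pointForm l c})).comp φ = Ideal.Quotient.mk _ := by
    apply MvPolynomial.ringHom_ext
    · intro r
      simp [φ]
    · intro i
      rcases eq_or_eq_one_sub l i with rfl | rfl
      · have : Ideal.Quotient.mk (Ideal.span {pointForm i c}) (.X i) =
            Ideal.Quotient.mk (Ideal.span {pointForm i c}) (.C c * .X (1 - i)) :=
          Ideal.Quotient.eq.2 (Ideal.mem_span_singleton_self _)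
        rw [this, RingHom.comp_apply, hφX, linePoint, if_pos rfl]
      · rw [RingHom.comp_apply, hφX, linePoint, if_neg (one_sub_ne l), map_one, one_mul]
  rw [← hq, RingHom.comp_apply, hφ, map_zero]

theorem lineEval_monomial (l : Fin 2) (m : Fin 2 →₀ ℕ) (a : K) :
    lineEval l (MvPolynomial.monomial m a) = C a * X ^ m l := by
  rw [lineEval, MvPolynomial.aeval_monomial, Finsupp.prod_fintype _ _ (by simp)]
  simp only [ite_pow, one_pow, Finset.prod_ite_eq', Finset.mem_univ, if_true]
  rfl

theorem coeff_lineEval (l : Fin 2) (h : MvPolynomial (Fin 2) K) (j : ℕ) :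
    (lineEval l h).coeff j = ∑ m ∈ h.support, if j = m l then h.coeff m else 0 := by
  conv_lhs => rw [h.as_sum]
  simp only [map_sum, finsetSum_coeff, lineEval_monomial, coeff_C_mul_X_pow]

theorem add_eq_of_coeff_ne_zero {h : MvPolynomial (Fin 2) K} {d : ℕ} (hh : h.IsHomogeneous d)
    {m : Fin 2 →₀ ℕ} (hm : h.coeff m ≠ 0) (l : Fin 2) : m l + m (1 - l) = d := by
  have := hh hm
  rw [show (1 : Fin 2 → ℕ) = fun _ => 1 from rfl, ← Finsupp.degree_eq_weight_one,
    Finsupp.degree_eq_sum, Fin.sum_univ_two] at this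
  fin_cases l
  · exact this
  · rw [← this, add_comm]; rfl

/-- In a binary form the exponent of one variable determines the monomial, so dehomogenization
merges no terms. -/
theorem coeff_lineEval_apply {h : MvPolynomial (Fin 2) K} {d : ℕ} (hh : h.IsHomogeneous d)
    (l : Fin 2) {m : Fin 2 →₀ ℕ} (hm : h.coeff m ≠ 0) :
    (lineEval l h).coeff (m l) = h.coeff m := by
  rw [coeff_lineEval, Finset.sum_eq_single m]
  · simp
  · intro m' hm' hne
    rw [if_neg]
    intro hl
    apply hne
    have h1 := add_eq_of_coeff_ne_zero hh hm l
    have h2 := add_eq_of_coeff_ne_zero hh (MvPolynomial.mem_support_iff.1 hm') l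
    ext i
    rcases eq_or_eq_one_sub l i with rfl | rfl <;> omega
  · intro h1
    exact absurd (MvPolynomial.mem_support_iff.2 hm) h1

theorem exists_of_coeff_lineEval_ne_zero {h : MvPolynomial (Fin 2) K} {l : Fin 2} {j : ℕ}
    (hj : (lineEval l h).coeff j ≠ 0) : ∃ m, h.coeff m ≠ 0 ∧ m l = j := by
  rw [coeff_lineEval] at hj
  obtain ⟨m, hm, h1⟩ := Finset.exists_ne_zero_of_sum_ne_zero hj
  by_cases h2 : j = m l
  · exact ⟨m, MvPolynomial.mem_support_iff.1 hm, h2.symm⟩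
  · rw [if_neg h2] at h1; exact absurd rfl h1

theorem lineEval_ne_zero {h : MvPolynomial (Fin 2) K} {d : ℕ} (hh : h.IsHomogeneous d)
    (h0 : h ≠ 0) (l : Fin 2) : lineEval l h ≠ 0 := by
  obtain ⟨m, hm⟩ := MvPolynomial.ne_zero_iff.1 h0
  intro h1
  apply hm
  rw [← coeff_lineEval_apply hh l hm, h1, coeff_zero]

/-- The degree of a binary form is the number of its roots on the projective line. -/
theorem degree_eq_sum_rootMultiplicity [IsAlgClosed K] {h : MvPolynomial (Fin 2) K} {d : ℕ}
    (hh : h.IsHomogeneous d) (h0 : h ≠ 0) (S : Finset K)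
    (hS : ∀ c, (lineEval 1 h).eval c = 0 → c ∈ S) :
    rootMultiplicity 0 (lineEval 0 h) + ∑ c ∈ S, rootMultiplicity c (lineEval 1 h) = d := by
  classical
  have hne := lineEval_ne_zero hh h0
  have h1 : ∑ c ∈ S, rootMultiplicity c (lineEval 1 h) = (lineEval 1 h).natDegree := by
    rw [← IsAlgClosed.card_roots_eq_natDegree]
    simp only [← count_roots]
    refine Multiset.sum_count_eq_card fun c hc => hS c ?_
    exact (mem_roots'.1 hc).2
  -- The multiplicity at `(0:1)` is the least exponent of `t₁`, the number of the other roots is the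
  -- greatest exponent of `t₂`. The two exponents of each monomial add up to `d`, so these extremes
  -- do too.
  rw [h1, rootMultiplicity_eq_natTrailingDegree']
  have hlead : (lineEval 1 h).coeff (lineEval 1 h).natDegree ≠ 0 := by
    rw [coeff_natDegree]; exact leadingCoeff_ne_zero.2 (hne 1)
  have htrail : (lineEval 0 h).coeff (lineEval 0 h).natTrailingDegree ≠ 0 :=
    trailingCoeff_nonzero_iff_nonzero.2 (hne 0)
  obtain ⟨m, hm, hmD⟩ := exists_of_coeff_lineEval_ne_zero hlead
  obtain ⟨m', hm', hmT⟩ := exists_of_coeff_lineEval_ne_zero htrail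
  have e1 := add_eq_of_coeff_ne_zero hh hm 0
  have e2 := add_eq_of_coeff_ne_zero hh hm' 0
  have i1 := natTrailingDegree_le_of_ne_zero ((coeff_lineEval_apply hh 0 hm).trans_ne hm)
  have i2 := le_natDegree_of_ne_zero ((coeff_lineEval_apply hh 1 hm').trans_ne hm')
  rw [sub_zero] at e1 e2
  omega

end Homogeneous

end BaseLocus

namespace BaseLocus

open Polynomial

/-! ### The content and its behaviour on the affine charts of the line -/

section Content

universe u

variable {K : Type u} [Field K]

theorem contentXY_dvd_coeff (R : KTXY K) (m : XY →₀ ℕ) : contentXY R ∣ R.coeff m := by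
  by_cases hm : m ∈ R.support
  · let _ : NormalizedGCDMonoid (MvPolynomial (Fin 2) K) := Classical.choice inferInstance
    exact Finset.gcd_dvd hm
  · rw [MvPolynomial.notMem_support_iff.1 hm]
    exact dvd_zero _

theorem dvd_contentXY {R : KTXY K} {d : MvPolynomial (Fin 2) K} (h : ∀ m, d ∣ R.coeff m) :
    d ∣ contentXY R := by
  let _ : NormalizedGCDMonoid (MvPolynomial (Fin 2) K) := Classical.choice inferInstance
  exact Finset.dvd_gcd fun m _ => h m

theorem dvd_contentXY_iff {R : KTXY K} {d : MvPolynomial (Fin 2) K} :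
    d ∣ contentXY R ↔ MvPolynomial.C d ∣ R := by
  rw [MvPolynomial.C_dvd_iff_dvd_coeff]
  exact ⟨fun h m => h.trans (contentXY_dvd_coeff R m), dvd_contentXY⟩

theorem contentXY_ne_zero {R : KTXY K} (hR : R ≠ 0) : contentXY R ≠ 0 := by
  obtain ⟨m, hm⟩ := MvPolynomial.ne_zero_iff.1 hR
  exact ne_zero_of_dvd_ne_zero hm (contentXY_dvd_coeff R m)

/-- The content does not change, up to a unit, under a change of the coordinates `x` and `y`. -/
theorem associated_contentXY (τ : KTXY K ≃ₐ[MvPolynomial (Fin 2) K] KTXY K) (R : KTXY K) :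
    Associated (contentXY (τ R)) (contentXY R) := by
  have h : ∀ d R, d ∣ contentXY R → ∀ τ : KTXY K ≃ₐ[MvPolynomial (Fin 2) K] KTXY K,
      d ∣ contentXY (τ R) := by
    intro d R hd τ
    rw [dvd_contentXY_iff] at hd ⊢
    have := map_dvd τ hd
    rwa [show τ (MvPolynomial.C d) = MvPolynomial.C d from τ.commutes d] at this
  refine associated_of_dvd_dvd ?_ (h _ _ dvd_rfl τ)
  simpa using h _ _ (dvd_refl (contentXY (τ R))) τ.symm

theorem totalDegree_eq_of_associated {p q : MvPolynomial (Fin 2) K} (h : Associated p q) :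
    p.totalDegree = q.totalDegree := by
  by_cases hp : p = 0
  · rw [hp] at h; rw [hp, h.eq_zero_iff.1 rfl]
  have hq : q ≠ 0 := fun hq => hp (h.eq_zero_iff.2 hq)
  exact le_antisymm (MvPolynomial.totalDegree_le_of_dvd_of_isDomain h.dvd hq)
    (MvPolynomial.totalDegree_le_of_dvd_of_isDomain h.symm.dvd hp)

variable {F : Type*} [Field F] [Algebra K F] [Algebra (KXY K) F]

variable (F) in
/-- Restriction to the affine line `t_l = s`, with the other coordinate equal to `1`, for
polynomials in `t₁, t₂, x, y`. -/
def lineSpec (l : Fin 2) : KTXY K →+* F[X] :=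
  MvPolynomial.eval₂Hom ((mapRingHom (algebraMap K F)).comp (lineEval l).toRingHom)
    fun i => C (algebraMap (KXY K) F (.X i))

theorem lineSpec_C (l : Fin 2) (h : MvPolynomial (Fin 2) K) :
    lineSpec F l (.C h) = (lineEval l h).map (algebraMap K F) := by
  simp [lineSpec]

theorem lineSpec_X (l : Fin 2) (i : XY) :
    lineSpec F l (.X i : KTXY K) = C (algebraMap (KXY K) F (.X i)) := by
  simp [lineSpec]

variable [IsScalarTower K (KXY K) F]

/-- At a point defined over `K`, the restriction is the image of a polynomial in `K[x, y]`, so its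
vanishing can be tested on coefficients. -/
theorem eval_lineSpec (l : Fin 2) (c : K) (R : KTXY K) :
    (lineSpec F l R).eval (algebraMap K F c) =
      algebraMap (KXY K) F (MvPolynomial.map (MvPolynomial.eval (linePoint l c)) R) := by
  have h : (evalRingHom (algebraMap K F c)).comp (lineSpec F l) =
      (algebraMap (KXY K) F).comp (MvPolynomial.map (MvPolynomial.eval (linePoint l c))) := by
    apply MvPolynomial.ringHom_ext
    · intro r
      simp only [RingHom.comp_apply, lineSpec_C, MvPolynomial.map_C, coe_evalRingHom, eval_map,
        eval₂_at_apply, eval_lineEval]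
      exact IsScalarTower.algebraMap_apply K (KXY K) F _
    · intro i
      simp [lineSpec_X]
  exact congrArg (fun φ : KTXY K →+* F => φ R) h

/-- For a polynomial in the indeterminates `x, y` whose coefficients are binary forms of the same
degree, the multiplicity of a root in `K` is the multiplicity of that root in the content. -/
theorem rootMultiplicity_lineSpec (hF : Function.Injective (algebraMap (KXY K) F)) {R : KTXY K}
    (hR : R ≠ 0) {N : ℕ} (hN : ∀ m, (R.coeff m).IsHomogeneous N) (l : Fin 2) (c : K) :
    rootMultiplicity (algebraMap K F c) (lineSpec F l R) =
      rootMultiplicity c (lineEval l (contentXY R)) ∧ lineSpec F l R ≠ 0 := by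
  have hcont := contentXY_ne_zero hR
  obtain ⟨R₀, hR₀⟩ := dvd_contentXY_iff.1 (dvd_refl (contentXY R))
  have hm : ∀ m, R.coeff m = contentXY R * R₀.coeff m := by
    intro m
    conv_lhs => rw [hR₀, MvPolynomial.coeff_C_mul]
  have hC : ∃ a, (contentXY R).IsHomogeneous a := by
    obtain ⟨m, hm0⟩ := MvPolynomial.ne_zero_iff.1 hR
    have h1 := hN m
    rw [hm m] at h1 hm0
    exact (exists_isHomogeneous_of_mul hm0 h1).1
  -- If all coefficients of `R₀` vanished at the point, they would share the factor `pointForm l c`,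
  -- and the content could be enlarged by it.
  have hR₀c : ∃ m, MvPolynomial.eval (linePoint l c) (R₀.coeff m) ≠ 0 := by
    by_contra! hcon
    apply not_isUnit_pointForm l c
    have h1 : ∀ m, pointForm l c ∣ R₀.coeff m := by
      intro m
      by_cases h0 : R₀.coeff m = 0
      · rw [h0]; exact dvd_zero _
      have h2 := hN m
      rw [hm m] at h2
      obtain ⟨b, hb⟩ := (exists_isHomogeneous_of_mul (mul_ne_zero hcont h0) h2).2
      exact pointForm_dvd hb l c (hcon m)
    have h2 : contentXY R * pointForm l c ∣ contentXY R :=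
      dvd_contentXY fun m => by rw [hm m]; exact mul_dvd_mul_left _ (h1 m)
    have h3 : contentXY R * pointForm l c ∣ contentXY R * 1 := by rwa [mul_one]
    exact isUnit_of_dvd_one ((mul_dvd_mul_iff_left hcont).1 h3)
  -- Hence the cofactor `R₀` does not contribute to the multiplicity of `c`.
  have heval : (lineSpec F l R₀).eval (algebraMap K F c) ≠ 0 := by
    rw [eval_lineSpec]
    intro h0
    obtain ⟨m, hm0⟩ := hR₀c
    apply hm0
    have h1 := hF (h0.trans (map_zero _).symm)
    rw [← MvPolynomial.coeff_map, h1, MvPolynomial.coeff_zero]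
  have hR₀ne : lineSpec F l R₀ ≠ 0 := by
    rintro h0; rw [h0, eval_zero] at heval; exact heval rfl
  obtain ⟨a, ha⟩ := hC
  have hlne : (lineEval l (contentXY R)).map (algebraMap K F) ≠ 0 := by
    rw [Ne, Polynomial.map_eq_zero_iff (algebraMap K F).injective]
    exact lineEval_ne_zero ha hcont l
  have hprod : lineSpec F l R =
      (lineEval l (contentXY R)).map (algebraMap K F) * lineSpec F l R₀ := by
    conv_lhs => rw [hR₀, map_mul, lineSpec_C]
  have hne := mul_ne_zero hlne hR₀ne
  rw [hprod]
  refine ⟨?_, hne⟩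
  rw [rootMultiplicity_mul hne, rootMultiplicity_eq_zero heval, add_zero,
    ← eq_rootMultiplicity_map (algebraMap K F).injective]

end Content

end BaseLocus

namespace BaseLocus

open Polynomial

/-! ### Generic combinations as polynomials in `t₃` -/

section Parametrization

universe u

variable {K : Type u} [Field K]

/-- The rearrangement `K[t₁, t₂, t₃] → K[t₁, t₂][t₃]`. -/
def polyT₃ : MvPolynomial (Fin 3) K →ₐ[K] (MvPolynomial (Fin 2) K)[X] :=
  MvPolynomial.aeval ![C (.X 0), C (.X 1), X]

theorem asPolyT₃_map_C (p : MvPolynomial (Fin 3) K) :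
    asPolyT₃ (MvPolynomial.map MvPolynomial.C p) =
      (polyT₃ p).map (MvPolynomial.C : _ →+* KTXY K) := by
  have h : (asPolyT₃ (K := K)).comp (MvPolynomial.map MvPolynomial.C) =
      (mapRingHom (MvPolynomial.C : _ →+* KTXY K)).comp polyT₃.toRingHom := by
    apply MvPolynomial.ringHom_ext
    · intro r
      simp [asPolyT₃, polyT₃, Polynomial.algebraMap_apply]
    · intro i
      fin_cases i <;> simp [asPolyT₃, polyT₃]
  exact congrArg (fun φ : MvPolynomial (Fin 3) K →+* _ => φ p) h

theorem asPolyT₃_C_X (i : XY) : asPolyT₃ (.C (.X i) : MvPolynomial (Fin 3) (KXY K)) =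
    C (.X i) := by
  simp [asPolyT₃]

theorem asPolyT₃_W₁ (p : Fin 4 → MvPolynomial (Fin 3) K) :
    asPolyT₃ (W₁ p) = genericComb MvPolynomial.C (fun i => .X (.inl i)) (fun i => polyT₃ (p i)) := by
  simp [W₁, genericComb, asPolyT₃_map_C, asPolyT₃_C_X]

theorem asPolyT₃_W₂ (p : Fin 4 → MvPolynomial (Fin 3) K) :
    asPolyT₃ (W₂ p) = genericComb MvPolynomial.C (fun i => .X (.inr i)) (fun i => polyT₃ (p i)) := by
  simp [W₂, genericComb, asPolyT₃_map_C, asPolyT₃_C_X]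

theorem polyT₃_monomial (m : Fin 3 →₀ ℕ) (a : K) :
    polyT₃ (MvPolynomial.monomial m a) =
      C (.C a * .X 0 ^ m 0 * .X 1 ^ m 1 : MvPolynomial (Fin 2) K) * X ^ m 2 := by
  rw [polyT₃, MvPolynomial.aeval_monomial, Finsupp.prod_fintype _ _ (by simp), Fin.prod_univ_three]
  simp [Polynomial.algebraMap_apply, mul_assoc]

theorem coeff_polyT₃ (p : MvPolynomial (Fin 3) K) (j : ℕ) :
    (polyT₃ p).coeff j = ∑ m ∈ p.support,
      if j = m 2 then (.C (p.coeff m) * .X 0 ^ m 0 * .X 1 ^ m 1 : MvPolynomial (Fin 2) K)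
      else 0 := by
  conv_lhs => rw [p.as_sum]
  simp only [map_sum, finsetSum_coeff, polyT₃_monomial, coeff_C_mul_X_pow]

theorem degree_eq_of_mem_support {p : MvPolynomial (Fin 3) K} {n : ℕ} (hp : p.IsHomogeneous n)
    {m : Fin 3 →₀ ℕ} (hm : m ∈ p.support) : m 0 + m 1 + m 2 = n := by
  have := hp (MvPolynomial.mem_support_iff.1 hm)
  rwa [show (1 : Fin 3 → ℕ) = fun _ => 1 from rfl, ← Finsupp.degree_eq_weight_one,
    Finsupp.degree_eq_sum, Fin.sum_univ_three] at this

theorem isHomogeneous_coeff_polyT₃ {p : MvPolynomial (Fin 3) K} {n : ℕ} (hp : p.IsHomogeneous n)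
    (j : ℕ) : ((polyT₃ p).coeff j).IsHomogeneous (n - j) := by
  rw [coeff_polyT₃]
  refine MvPolynomial.IsHomogeneous.sum _ _ _ fun m hm => ?_
  split_ifs with h
  · have h1 := degree_eq_of_mem_support hp hm
    have h2 : n - j = 0 + 1 * m 0 + 1 * m 1 := by omega
    rw [h2]
    exact ((MvPolynomial.isHomogeneous_C _ _).mul ((MvPolynomial.isHomogeneous_X _ _).pow _)).mul
      ((MvPolynomial.isHomogeneous_X _ _).pow _)
  · exact MvPolynomial.isHomogeneous_zero _ _ _

theorem natDegree_polyT₃_le {p : MvPolynomial (Fin 3) K} {n : ℕ} (hp : p.IsHomogeneous n) :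
    (polyT₃ p).natDegree ≤ n := by
  rw [natDegree_le_iff_coeff_eq_zero]
  intro j hj
  rw [coeff_polyT₃]
  refine Finset.sum_eq_zero fun m hm => if_neg ?_
  have := degree_eq_of_mem_support hp hm
  omega

/-- Here the condition at `(0:0:1)` enters: it makes the top coefficient in `t₃` a nonzero constant.
-/
theorem coeff_polyT₃_top {p : MvPolynomial (Fin 3) K} {n : ℕ} (hp : p.IsHomogeneous n) :
    (polyT₃ p).coeff n = .C (MvPolynomial.eval ![0, 0, 1] p) := by
  rw [coeff_polyT₃, MvPolynomial.eval_eq', map_sum]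
  refine Finset.sum_congr rfl fun m hm => ?_
  have h1 := degree_eq_of_mem_support hp hm
  rw [Fin.prod_univ_three]
  by_cases h : n = m 2
  · have h0 : m 0 = 0 := by omega
    have h2 : m 1 = 0 := by omega
    rw [if_pos h]
    simp [h0, h2]
  · rw [if_neg h]
    have h2 : m 0 ≠ 0 ∨ m 1 ≠ 0 := by omega
    rcases h2 with h2 | h2 <;> simp [h2]

theorem isUnit_of_dvd_polyT₃ {p : Fin 4 → MvPolynomial (Fin 3) K} (hgcd : GcdEqOne p)
    (d : (MvPolynomial (Fin 2) K)[X]) (hd : ∀ i, d ∣ polyT₃ (p i)) : IsUnit d := by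
  let β : (MvPolynomial (Fin 2) K)[X] →+* MvPolynomial (Fin 3) K :=
    eval₂RingHom (MvPolynomial.aeval ![.X 0, .X 1] : MvPolynomial (Fin 2) K →ₐ[K] _).toRingHom
      (.X 2)
  have h1 : β.comp (polyT₃ (K := K)).toRingHom = RingHom.id _ := by
    apply MvPolynomial.ringHom_ext
    · intro r
      simp [β, polyT₃, Polynomial.algebraMap_apply]
    · intro i
      fin_cases i <;> simp [β, polyT₃]
  have h2 : (polyT₃ (K := K)).toRingHom.comp β = RingHom.id _ := by
    apply Polynomial.ringHom_ext'
    · apply MvPolynomial.ringHom_ext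
      · intro r
        simp [β, polyT₃, Polynomial.algebraMap_apply]
      · intro i
        fin_cases i <;> simp [β, polyT₃]
    · simp [β, polyT₃]
  have h3 : IsUnit (β d) := hgcd _ fun i => by
    have := map_dvd β (hd i)
    rwa [show β (polyT₃ (p i)) = p i from
      congrArg (fun φ : MvPolynomial (Fin 3) K →+* _ => φ (p i)) h1] at this
  have h4 := h3.map (polyT₃ (K := K)).toRingHom
  rwa [show (polyT₃ (K := K)).toRingHom (β d) = d from
      congrArg (fun φ : (MvPolynomial (Fin 2) K)[X] →+* _ => φ d) h2] at h4

/-! ### The degree and the homogeneity of the resultant -/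

variable {p : Fin 4 → MvPolynomial (Fin 3) K} {n : ℕ} {ι : Fin 4 → XY}

theorem coeff_genericComb {A B : Type*} [CommRing A] [CommRing B] (φ : A →+* B) (x : Fin 4 → B)
    (P : Fin 4 → A[X]) (j : ℕ) :
    (genericComb φ x P).coeff j = ∑ i, x i * φ ((P i).coeff j) := by
  simp [genericComb, finsetSum_coeff]

theorem coeff_genericComb_polyT₃ (hhom : ∀ i, (p i).IsHomogeneous n) :
    (genericComb (MvPolynomial.C : _ →+* KTXY K) (fun i => .X (ι i))
      (fun i => polyT₃ (p i))).coeff n = MvPolynomial.map MvPolynomial.C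
        (∑ i, .C (MvPolynomial.eval ![0, 0, 1] (p i)) * .X (ι i) : KXY K) := by
  simp only [coeff_genericComb, coeff_polyT₃_top (hhom _), map_sum, map_mul, MvPolynomial.map_C, MvPolynomial.map_X]
  exact Finset.sum_congr rfl fun i _ => mul_comm _ _

theorem leadingForm_ne_zero (hι : Function.Injective ι)
    (hpt : MvPolynomial.eval ![0, 0, 1] (p 3) ≠ 0) :
    (∑ i, .C (MvPolynomial.eval ![0, 0, 1] (p i)) * .X (ι i) : KXY K) ≠ 0 := by
  classical
  intro h
  have h1 := congrArg (MvPolynomial.coeff (Finsupp.single (ι 3) 1)) h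
  simp only [MvPolynomial.coeff_sum, MvPolynomial.coeff_C_mul, MvPolynomial.coeff_X,
    Finsupp.single_left_inj one_ne_zero, hι.eq_iff, mul_ite, mul_one, mul_zero,
    Finset.sum_ite_eq', Finset.mem_univ, if_true, MvPolynomial.coeff_zero] at h1
  exact hpt h1

theorem natDegree_genericComb_polyT₃ (hhom : ∀ i, (p i).IsHomogeneous n)
    (hι : Function.Injective ι) (hpt : MvPolynomial.eval ![0, 0, 1] (p 3) ≠ 0) :
    (genericComb (MvPolynomial.C : _ →+* KTXY K) (fun i => .X (ι i))
      (fun i => polyT₃ (p i))).natDegree = n := by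
  apply natDegree_eq_of_le_of_coeff_ne_zero
  · refine natDegree_sum_le_of_forall_le _ _ fun i _ => ?_
    exact (natDegree_C_mul_le _ _).trans (natDegree_map_le.trans (natDegree_polyT₃_le (hhom i)))
  · rw [coeff_genericComb_polyT₃ hhom]
    intro h
    exact leadingForm_ne_zero hι hpt
      (MvPolynomial.map_injective _ (MvPolynomial.C_injective (Fin 2) K) (h.trans (map_zero _).symm))

/-- The coefficient of `t₃ ^ j` has degree `n - j` in `t₁, t₂`, so scaling these by `λ` has the
effect of multiplying the roots in `t₃` by `λ`. -/
theorem map_scaleHom_genericComb (hhom : ∀ i, (p i).IsHomogeneous n)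
    (hι : Function.Injective ι) (hpt : MvPolynomial.eval ![0, 0, 1] (p 3) ≠ 0) :
    (genericComb (MvPolynomial.C : _ →+* KTXY K) (fun i => .X (ι i))
      (fun i => polyT₃ (p i))).map (MvPolynomial.map scaleHom.toRingHom) =
    ((genericComb (MvPolynomial.C : _ →+* KTXY K) (fun i => .X (ι i))
      (fun i => polyT₃ (p i))).map (MvPolynomial.map C)).scaleRoots (.C X) := by
  ext1 j
  rw [coeff_scaleRoots, natDegree_map_eq_of_injective (MvPolynomial.map_injective _ C_injective),
    natDegree_genericComb_polyT₃ hhom hι hpt]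
  have key : ∀ i, scaleHom.toRingHom ((polyT₃ (p i)).coeff j) =
      C ((polyT₃ (p i)).coeff j) * X ^ (n - j) := fun i =>
    isHomogeneous_iff_scaleHom.1 (isHomogeneous_coeff_polyT₃ (hhom i) j)
  rw [coeff_map, coeff_map, coeff_genericComb, map_sum, map_sum, Finset.sum_mul]
  refine Finset.sum_congr rfl fun i _ => ?_
  rw [map_mul, map_mul, MvPolynomial.map_C, MvPolynomial.map_C, key,
    MvPolynomial.map_X, MvPolynomial.map_X, map_mul, map_pow, mul_assoc]

/-- The coefficients of the resultant are homogeneous in `t₁, t₂`. -/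
theorem isHomogeneous_coeff_resultant {ι' : Fin 4 → XY} (hhom : ∀ i, (p i).IsHomogeneous n)
    (hι : Function.Injective ι) (hι' : Function.Injective ι')
    (hpt : MvPolynomial.eval ![0, 0, 1] (p 3) ≠ 0) (m : XY →₀ ℕ) :
    (MvPolynomial.coeff m (resultant
      (genericComb (MvPolynomial.C : _ →+* KTXY K) (fun i => .X (ι i)) (fun i => polyT₃ (p i)))
      (genericComb (MvPolynomial.C : _ →+* KTXY K) (fun i => .X (ι' i))
        (fun i => polyT₃ (p i))))).IsHomogeneous (n * n) := by
  set f := genericComb (MvPolynomial.C : _ →+* KTXY K) (fun i => .X (ι i))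
    (fun i => polyT₃ (p i)) with hf
  set g := genericComb (MvPolynomial.C : _ →+* KTXY K) (fun i => .X (ι' i))
    (fun i => polyT₃ (p i)) with hg
  have hfn : f.natDegree = n := natDegree_genericComb_polyT₃ hhom hι hpt
  have hgn : g.natDegree = n := natDegree_genericComb_polyT₃ hhom hι' hpt
  have hinj := MvPolynomial.map_injective (σ := XY)
    (C : MvPolynomial (Fin 2) K →+* (MvPolynomial (Fin 2) K)[X]) C_injective
  -- Scaling the roots of two polynomials of degree `n` by `λ` multiplies their resultant by `λ ^ (n
  -- * n)`.
  have key : MvPolynomial.map scaleHom.toRingHom (resultant f g) =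
      (.C X) ^ (n * n) * MvPolynomial.map C (resultant f g) := by
    have h1 := resultant_map_map (S := MvPolynomial XY (MvPolynomial (Fin 2) K)[X]) f g
      f.natDegree g.natDegree
      (MvPolynomial.map (σ := XY) (scaleHom (K := K) (σ := Fin 2)).toRingHom)
    have h2 := resultant_map_map (S := MvPolynomial XY (MvPolynomial (Fin 2) K)[X]) f g
      f.natDegree g.natDegree
      (MvPolynomial.map (σ := XY) (C : MvPolynomial (Fin 2) K →+* (MvPolynomial (Fin 2) K)[X]))
    rw [map_scaleHom_genericComb hhom hι hpt, map_scaleHom_genericComb hhom hι' hpt] at h1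
    refine h1.symm.trans (Eq.trans ?_ (congrArg _ h2))
    have := resultant_scaleRoots (f.map (MvPolynomial.map C)) (g.map (MvPolynomial.map C))
      (.C X : MvPolynomial XY (MvPolynomial (Fin 2) K)[X])
    simpa only [natDegree_scaleRoots, natDegree_map_eq_of_injective hinj, hfn, hgn] using this
  rw [isHomogeneous_iff_scaleHom]
  have h1 := congrArg (MvPolynomial.coeff m) key
  rw [MvPolynomial.coeff_map, ← map_pow, MvPolynomial.coeff_C_mul, MvPolynomial.coeff_map,
    mul_comm] at h1
  exact h1

end Parametrization

end BaseLocus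

namespace BaseLocus

open Polynomial

/-! ### Restriction to the lines through `(0:0:1)` -/

section Specialization

universe u

variable {K : Type u} [Field K]

theorem asPolyT₃_C (r : KXY K) : asPolyT₃ (.C r : MvPolynomial (Fin 3) (KXY K)) =
    C (MvPolynomial.map MvPolynomial.C r) := by
  simp [asPolyT₃]


variable {F : Type u} [Field F] [Algebra K F] [Algebra (KXY K) F]

/-- The restrictions of the `pᵢ` to the line through `(0 : 0 : 1)` and `linePoint l c`. -/
def restrictLine (p : Fin 4 → MvPolynomial (Fin 3) K) (l : Fin 2) (c : K) (i : Fin 4) : K[X] :=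
  (polyT₃ (p i)).map (MvPolynomial.eval (linePoint l c))

theorem eval_map_lineSpec_genericComb {p : Fin 4 → MvPolynomial (Fin 3) K}
    {x : Fin 4 → KTXY K} (l : Fin 2) (c : K) (z : F) :
    (((genericComb (MvPolynomial.C : _ →+* KTXY K) x
      (fun i => polyT₃ (p i))).map (lineSpec F l)).map (evalRingHom (algebraMap K F c))).eval z =
    ∑ i, (lineSpec F l (x i)).eval (algebraMap K F c) * aeval z (restrictLine p l c i) := by
  rw [Polynomial.map_map, map_genericComb, eval_genericComb]
  refine Finset.sum_congr rfl fun i _ => congrArg₂ _ rfl ?_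
  rw [restrictLine, aeval_def, eval₂_map]
  congr 1
  ext h
  · simp only [RingHom.comp_apply, lineSpec_C, coe_evalRingHom, eval_map, eval₂_at_apply,
      eval_lineEval]
  · simp only [RingHom.comp_apply, lineSpec_C, coe_evalRingHom, eval_map, eval₂_at_apply,
      eval_lineEval]

variable [IsScalarTower K (KXY K) F]

theorem lineSpec_map_C (l : Fin 2) (r : KXY K) :
    lineSpec F l (MvPolynomial.map MvPolynomial.C r) = C (algebraMap (KXY K) F r) := by
  have h : (lineSpec F l).comp (MvPolynomial.map (MvPolynomial.C : K →+* MvPolynomial (Fin 2) K)) =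
      (C : F →+* F[X]).comp (algebraMap (KXY K) F) := by
    apply MvPolynomial.ringHom_ext
    · intro r
      simp only [RingHom.comp_apply, MvPolynomial.map_C, lineSpec_C]
      have : lineEval l (MvPolynomial.C r) = C r := MvPolynomial.aeval_C _ r
      rw [this, map_C]
      exact congrArg C (IsScalarTower.algebraMap_apply K (KXY K) F r)
    · intro i
      simp [lineSpec_X]
  exact congrArg (fun φ : KXY K →+* F[X] => φ r) h

theorem dehomogenize_X (k i : Fin 3) :
    dehomogenize k (.X i : MvPolynomial (Fin 3) F) =
      Fin.insertNth (α := fun _ => MvPolynomial (Fin 2) F) k 1 (fun j => .X j) i := by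
  simp [dehomogenize]

/-- Links the polynomials whose resultant is taken with the local equations that define the
multiplicities. Keeping `t_l` means setting `t_{1-l} = 1`, whence the chart; the remaining
coordinates are `t_l, t₃`, in this order. -/
theorem equivMvPolynomial_map_lineSpec (l : Fin 2) (f : MvPolynomial (Fin 3) (KXY K)) :
    Polynomial.Bivariate.equivMvPolynomial F ((asPolyT₃ f).map (lineSpec F l)) =
      dehomogenize (1 - l).castSucc (MvPolynomial.map (algebraMap (KXY K) F) f) := by
  have h : ((Polynomial.Bivariate.equivMvPolynomial F : F[X][X] →+* _).comp
      (mapRingHom (lineSpec F l))).comp asPolyT₃ =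
      (dehomogenize (F := F) (1 - l).castSucc).toRingHom.comp
        (MvPolynomial.map (algebraMap (KXY K) F)) := by
    apply MvPolynomial.ringHom_ext
    · intro r
      simp only [RingHom.comp_apply, asPolyT₃_C, coe_mapRingHom, map_C, lineSpec_map_C,
        MvPolynomial.map_C]
      exact (Polynomial.Bivariate.equivMvPolynomial_C_C).trans (MvPolynomial.aeval_C _ _).symm
    · intro i
      have h1 : asPolyT₃ (.X i : MvPolynomial (Fin 3) (KXY K)) =
          (![C (.C (.X 0)), C (.C (.X 1)), X] : Fin 3 → (KTXY K)[X]) i := by simp [asPolyT₃]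
      have h2 : (dehomogenize (F := F) (1 - l).castSucc).toRingHom (.X i) = _ :=
        dehomogenize_X (1 - l).castSucc i
      simp only [RingHom.comp_apply, MvPolynomial.map_X, h1, h2]
      fin_cases l <;> fin_cases i <;>
        simp [lineSpec_C, lineEval, Fin.insertNth, Fin.succAboveCases]
  exact congrArg (fun φ : MvPolynomial (Fin 3) (KXY K) →+* _ => φ f) h

variable {p : Fin 4 → MvPolynomial (Fin 3) K} {n : ℕ}

/-- The leading coefficient is a nonzero form in the indeterminates alone, free of `t₁, t₂`, so it
survives the restriction as a unit. -/
theorem natDegree_map_lineSpec {ι : Fin 4 → XY} (hhom : ∀ i, (p i).IsHomogeneous n)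
    (hι : Function.Injective ι) (hpt : MvPolynomial.eval ![0, 0, 1] (p 3) ≠ 0)
    (hF : Function.Injective (algebraMap (KXY K) F)) (l : Fin 2) :
    ((genericComb (MvPolynomial.C : _ →+* KTXY K) (fun i => .X (ι i))
      (fun i => polyT₃ (p i))).map (lineSpec F l)).natDegree = n ∧
    IsUnit ((genericComb (MvPolynomial.C : _ →+* KTXY K) (fun i => .X (ι i))
      (fun i => polyT₃ (p i))).map (lineSpec F l)).leadingCoeff := by
  have hco : ((genericComb (MvPolynomial.C : _ →+* KTXY K) (fun i => .X (ι i))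
      (fun i => polyT₃ (p i))).map (lineSpec F l)).coeff n = C (algebraMap (KXY K) F
        (∑ i, .C (MvPolynomial.eval ![0, 0, 1] (p i)) * .X (ι i))) := by
    rw [coeff_map, coeff_genericComb_polyT₃ hhom, lineSpec_map_C]
  have hne : algebraMap (KXY K) F
      (∑ i, .C (MvPolynomial.eval ![0, 0, 1] (p i)) * .X (ι i)) ≠ 0 := fun h =>
    leadingForm_ne_zero hι hpt (hF (h.trans (map_zero _).symm))
  have hdeg : ((genericComb (MvPolynomial.C : _ →+* KTXY K) (fun i => .X (ι i))
      (fun i => polyT₃ (p i))).map (lineSpec F l)).natDegree = n := by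
    apply natDegree_eq_of_le_of_coeff_ne_zero
    · exact natDegree_map_le.trans (natDegree_genericComb_polyT₃ hhom hι hpt).le
    · rw [hco]; exact C_ne_zero.2 hne
  refine ⟨hdeg, ?_⟩
  rw [leadingCoeff, hdeg, hco]
  exact (isUnit_iff_ne_zero.2 hne).map C

theorem resT₃_W_ne_zero (hgcd : GcdEqOne p) (hhom : ∀ i, (p i).IsHomogeneous n)
    (hpt : MvPolynomial.eval ![0, 0, 1] (p 3) ≠ 0) : resT₃ (W₁ p) (W₂ p) ≠ 0 := by
  rw [resT₃, asPolyT₃_W₁, asPolyT₃_W₂]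
  refine resultant_genericComb_ne_zero _ ⟨3, ?_⟩ (isUnit_of_dvd_polyT₃ hgcd)
  have h1 := coeff_polyT₃_top (hhom 3)
  have h2 : (polyT₃ (p 3)).natDegree = n := by
    apply natDegree_eq_of_le_of_coeff_ne_zero (natDegree_polyT₃_le (hhom 3))
    rw [h1]
    simpa using hpt
  rw [leadingCoeff, h2, h1]
  exact (isUnit_iff_ne_zero.2 hpt).map MvPolynomial.C

theorem isHomogeneous_coeff_resT₃ (hhom : ∀ i, (p i).IsHomogeneous n)
    (hpt : MvPolynomial.eval ![0, 0, 1] (p 3) ≠ 0) (m : XY →₀ ℕ) :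
    ((resT₃ (W₁ p) (W₂ p)).coeff m).IsHomogeneous (n * n) := by
  rw [resT₃, asPolyT₃_W₁, asPolyT₃_W₂]
  exact isHomogeneous_coeff_resultant hhom Sum.inl_injective Sum.inr_injective hpt m

theorem restrictLine_ne_zero (hhom : ∀ i, (p i).IsHomogeneous n)
    (hpt : MvPolynomial.eval ![0, 0, 1] (p 3) ≠ 0) (l : Fin 2) (c : K) :
    restrictLine p l c 3 ≠ 0 := by
  intro h
  have h1 := congrArg (fun q => q.coeff n) h
  simp only [restrictLine, coeff_map, coeff_polyT₃_top (hhom 3), MvPolynomial.eval_C,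
    coeff_zero] at h1
  exact hpt h1

/-- The common zeros of the two generic curves on a line through `(0 : 0 : 1)` that is defined over
`K` are base points, and their multiplicities sum up to the multiplicity of the corresponding root
of the content of the resultant. -/
theorem sum_affineMult_eq_rootMultiplicity_content [IsAlgClosed K] [IsAlgClosed F]
    (hF : Function.Injective (algebraMap (KXY K) F))
    (hgcd : GcdEqOne p) (hhom : ∀ i, (p i).IsHomogeneous n)
    (hpt : MvPolynomial.eval ![0, 0, 1] (p 3) ≠ 0) (l : Fin 2) (c : K) (Γ : Finset K)
    (hΓ : ∀ z, z ∈ Γ ↔ ∀ i, (restrictLine p l c i).eval z = 0) :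
    (∑ z ∈ Γ, affineMult
      (dehomogenize (1 - l).castSucc (MvPolynomial.map (algebraMap (KXY K) F) (W₁ p)))
      (dehomogenize (1 - l).castSucc (MvPolynomial.map (algebraMap (KXY K) F) (W₂ p)))
      ![algebraMap K F c, algebraMap K F z] =
      (rootMultiplicity c (lineEval l (contentXY (resT₃ (W₁ p) (W₂ p)))) : ℕ∞)) ∧
    (Γ.Nonempty → (lineEval l (contentXY (resT₃ (W₁ p) (W₂ p)))).eval c = 0) := by
  classical
  have hR0 := resT₃_W_ne_zero hgcd hhom hpt
  obtain ⟨hmult, hR⟩ := rootMultiplicity_lineSpec hF hR0 (isHomogeneous_coeff_resT₃ hhom hpt) l c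
  obtain ⟨hf, hfu⟩ := natDegree_map_lineSpec hhom (Sum.inl_injective (β := Fin 4)) hpt hF l
  obtain ⟨hg, -⟩ := natDegree_map_lineSpec hhom (Sum.inr_injective (α := Fin 4)) hpt hF l
  have hf' := natDegree_genericComb_polyT₃ hhom (Sum.inl_injective (β := Fin 4)) hpt
  have hg' := natDegree_genericComb_polyT₃ hhom (Sum.inr_injective (α := Fin 4)) hpt
  have e₁ := eval_map_lineSpec_genericComb (F := F) (p := p) (x := fun i => .X (.inl i)) l c
  have e₂ := eval_map_lineSpec_genericComb (F := F) (p := p) (x := fun i => .X (.inr i)) l c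
  rw [← asPolyT₃_W₁] at hf hfu hf' e₁
  rw [← asPolyT₃_W₂] at hg hg' e₂
  -- Since no degree drops, the resultant commutes with the restriction.
  have hres : resultant ((asPolyT₃ (W₁ p)).map (lineSpec F l))
      ((asPolyT₃ (W₂ p)).map (lineSpec F l)) = lineSpec F l (resT₃ (W₁ p) (W₂ p)) := by
    rw [hf, hg, resultant_map_map, resT₃, hf', hg']
  rw [← hres] at hmult hR
  have hmem : ∀ z, z ∈ Γ.image (algebraMap K F) ↔
      (((asPolyT₃ (W₁ p)).map (lineSpec F l)).map (evalRingHom (algebraMap K F c))).eval z = 0 ∧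
      (((asPolyT₃ (W₂ p)).map (lineSpec F l)).map
        (evalRingHom (algebraMap K F c))).eval z = 0 := by
    intro z
    rw [e₁, e₂]
    simp only [lineSpec_X, eval_C, Finset.mem_image]
    constructor
    · rintro ⟨w, hw, rfl⟩
      rw [hΓ] at hw
      simp [aeval_algebraMap_apply, hw]
    · rintro ⟨h1, h2⟩
      have h3 := aeval_eq_zero_of_sum_eq_zero (algebraicIndependent_XY K hF) _
        ⟨3, restrictLine_ne_zero hhom hpt l c⟩ z h1 h2
      -- The common zero is a root of a nonzero polynomial over the algebraically closed field `K`,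
      -- so it lies in `K`.
      have hint : IsIntegral K z :=
        isAlgebraic_iff_isIntegral.1 ⟨_, restrictLine_ne_zero hhom hpt l c, h3 3⟩
      obtain ⟨w, rfl⟩ := minpoly.mem_range_of_degree_eq_one K z
        (IsAlgClosed.degree_eq_one_of_irreducible K (minpoly.irreducible hint))
      refine ⟨w, (hΓ w).2 fun i => ?_, rfl⟩
      have h4 := h3 i
      rw [aeval_algebraMap_apply] at h4
      exact (algebraMap K F).injective (h4.trans (map_zero _).symm)
  have hsum := sum_affineMult_eq_rootMultiplicity_resultant hfu hR (algebraMap K F c)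
    (Γ.image (algebraMap K F)) hmem
  rw [Finset.sum_image (fun x _ y _ h => (algebraMap K F).injective h), hmult] at hsum
  constructor
  · rw [← hsum]
    simp only [equivMvPolynomial_map_lineSpec]
  · rintro ⟨z, hz⟩
    obtain ⟨h1, h2⟩ := (hmem (algebraMap K F z)).1 (Finset.mem_image_of_mem _ hz)
    obtain ⟨a, b, hab⟩ := Ideal.mem_span_pair.1 (C_resultant_mem_span
      (g := (asPolyT₃ (W₂ p)).map (lineSpec F l)) hfu)
    have h4 := congrArg (fun q => (q.map (evalRingHom (algebraMap K F c))).eval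
      (algebraMap K F z)) hab
    simp only [Polynomial.map_add, Polynomial.map_mul, eval_add, eval_mul, h1, h2, mul_zero,
      add_zero, map_C, eval_C, coe_evalRingHom] at h4
    have h5 : 0 < rootMultiplicity (algebraMap K F c) _ := (rootMultiplicity_pos hR).2 h4.symm
    rw [hmult] at h5
    exact (rootMultiplicity_pos'.1 h5).2

end Specialization

end BaseLocus

namespace BaseLocus

open Polynomial

/-! ### Projective transformations of the target -/

section Transformation

universe u

variable {K : Type u} [Field K]

/-- The substitution `xⱼ ↦ ∑ᵢ Mᵢⱼ xᵢ`, `yⱼ ↦ ∑ᵢ Mᵢⱼ yᵢ`. -/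
def matrixSubst (M : Matrix (Fin 4) (Fin 4) K) :
    KTXY K →ₐ[MvPolynomial (Fin 2) K] KTXY K :=
  MvPolynomial.aeval (Sum.elim (fun j => ∑ i, .C (.C (M i j)) * .X (.inl i))
    (fun j => ∑ i, .C (.C (M i j)) * .X (.inr i)))

theorem matrixSubst_inl (M : Matrix (Fin 4) (Fin 4) K) (j : Fin 4) :
    matrixSubst M (.X (.inl j)) = ∑ i, .C (.C (M i j)) * .X (.inl i) := by
  simp [matrixSubst]

theorem matrixSubst_inr (M : Matrix (Fin 4) (Fin 4) K) (j : Fin 4) :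
    matrixSubst M (.X (.inr j)) = ∑ i, .C (.C (M i j)) * .X (.inr i) := by
  simp [matrixSubst]

theorem matrixSubst_C (M : Matrix (Fin 4) (Fin 4) K) (a : MvPolynomial (Fin 2) K) :
    matrixSubst M (.C a) = .C a :=
  (matrixSubst M).commutes a

theorem matrixSubst_comp (M N : Matrix (Fin 4) (Fin 4) K) :
    (matrixSubst M).comp (matrixSubst N) = matrixSubst (M * N) := by
  apply MvPolynomial.algHom_ext
  rintro (j | j)
  · simp only [AlgHom.comp_apply, matrixSubst_inl, map_sum, map_mul, matrixSubst_C,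
      Finset.mul_sum, Matrix.mul_apply, Finset.sum_mul]
    rw [Finset.sum_comm]
    refine Finset.sum_congr rfl fun i _ => Finset.sum_congr rfl fun k _ => ?_
    ring
  · simp only [AlgHom.comp_apply, matrixSubst_inr, map_sum, map_mul, matrixSubst_C,
      Finset.mul_sum, Matrix.mul_apply, Finset.sum_mul]
    rw [Finset.sum_comm]
    refine Finset.sum_congr rfl fun i _ => Finset.sum_congr rfl fun k _ => ?_
    ring

theorem matrixSubst_one : matrixSubst (1 : Matrix (Fin 4) (Fin 4) K) = AlgHom.id _ _ := by
  apply MvPolynomial.algHom_ext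
  rintro (j | j)
  · rw [matrixSubst_inl, Finset.sum_eq_single j] <;> simp +contextual
  · rw [matrixSubst_inr, Finset.sum_eq_single j] <;> simp +contextual

/-- The automorphism of `K[t₁, t₂][x, y]` induced by a projective transformation. -/
def transformEquiv (L : GL (Fin 4) K) : KTXY K ≃ₐ[MvPolynomial (Fin 2) K] KTXY K :=
  AlgEquiv.ofAlgHom (matrixSubst L) (matrixSubst (L⁻¹ : GL (Fin 4) K))
    (by rw [matrixSubst_comp, ← Units.val_mul, mul_inv_cancel, Units.val_one, matrixSubst_one])
    (by rw [matrixSubst_comp, ← Units.val_mul, inv_mul_cancel, Units.val_one, matrixSubst_one])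

theorem polyT₃_transform (L : GL (Fin 4) K) (p : Fin 4 → MvPolynomial (Fin 3) K) (i : Fin 4) :
    polyT₃ (transform L p i) =
      ∑ j, C (.C ((L : Matrix (Fin 4) (Fin 4) K) i j)) * polyT₃ (p j) := by
  simp only [transform, map_sum, map_mul]
  refine Finset.sum_congr rfl fun j _ => congrArg₂ _ ?_ rfl
  exact MvPolynomial.aeval_C _ _

/-- Regrouping `∑ᵢ xᵢ Lᵢ(p) = ∑ⱼ (∑ᵢ Lᵢⱼ xᵢ) pⱼ` moves `L` from the parametrization to the
indeterminates. -/
theorem genericComb_transform (L : GL (Fin 4) K) (p : Fin 4 → MvPolynomial (Fin 3) K)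
    (ι : Fin 4 → XY)
    (hι : ∀ j, transformEquiv L (.X (ι j)) =
      ∑ i, .C (.C ((L : Matrix (Fin 4) (Fin 4) K) i j)) * .X (ι i)) :
    genericComb (MvPolynomial.C : _ →+* KTXY K) (fun i => .X (ι i))
      (fun i => polyT₃ (transform L p i)) =
    (genericComb (MvPolynomial.C : _ →+* KTXY K) (fun i => .X (ι i))
      (fun i => polyT₃ (p i))).map (transformEquiv L).toRingHom := by
  ext1 k
  rw [coeff_map, coeff_genericComb, coeff_genericComb, map_sum]
  have h1 : ∀ j, (transformEquiv L).toRingHom (.X (ι j) * .C ((polyT₃ (p j)).coeff k)) =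
      ∑ i, .C (.C ((L : Matrix (Fin 4) (Fin 4) K) i j)) * .X (ι i) *
        .C ((polyT₃ (p j)).coeff k) := by
    intro j
    rw [map_mul, ← Finset.sum_mul, ← hι j]
    exact congrArg _ ((transformEquiv L).commutes ((polyT₃ (p j)).coeff k))
  simp only [h1]
  rw [Finset.sum_comm]
  refine Finset.sum_congr rfl fun i _ => ?_
  rw [polyT₃_transform, finsetSum_coeff, map_sum, Finset.mul_sum]
  refine Finset.sum_congr rfl fun j _ => ?_
  rw [coeff_C_mul, map_mul]
  ring

theorem resT₃_transform (L : GL (Fin 4) K) (p : Fin 4 → MvPolynomial (Fin 3) K) :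
    resT₃ (W₁ (transform L p)) (W₂ (transform L p)) =
      transformEquiv L (resT₃ (W₁ p) (W₂ p)) := by
  have hinj : Function.Injective (transformEquiv L).toRingHom := (transformEquiv L).injective
  rw [resT₃, resT₃, asPolyT₃_W₁, asPolyT₃_W₂, asPolyT₃_W₁, asPolyT₃_W₂,
    genericComb_transform L p Sum.inl (matrixSubst_inl _),
    genericComb_transform L p Sum.inr (matrixSubst_inr _),
    natDegree_map_eq_of_injective hinj, natDegree_map_eq_of_injective hinj, resultant_map_map]
  rfl

theorem totalDegree_contentXY_transform (L : GL (Fin 4) K)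
    (p : Fin 4 → MvPolynomial (Fin 3) K) :
    (contentXY (resT₃ (W₁ (transform L p)) (W₂ (transform L p)))).totalDegree =
      (contentXY (resT₃ (W₁ p) (W₂ p))).totalDegree := by
  rw [resT₃_transform]
  exact totalDegree_eq_of_associated (associated_contentXY _ _)

end Transformation

/-! ### Normalized coordinates of base points -/

section BasePoints

universe u

variable {K : Type u} [Field K]

theorem eval_smul_of_isHomogeneous {σ : Type*} {h : MvPolynomial σ K} {n : ℕ}
    (hh : h.IsHomogeneous n) (a : K) (v : σ → K) :
    MvPolynomial.eval (a • v) h = a ^ n * MvPolynomial.eval v h := by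
  have h1 : ((eval₂RingHom (MvPolynomial.eval v) a).comp (scaleHom (K := K) (σ := σ)).toRingHom) =
      MvPolynomial.eval (a • v) := by
    apply MvPolynomial.ringHom_ext
    · intro r
      simp [scaleHom, Polynomial.algebraMap_apply]
    · intro i
      simp [scaleHom, mul_comm a]
  rw [← h1, RingHom.comp_apply]
  have h2 : (scaleHom (K := K) (σ := σ)).toRingHom h = _ := isHomogeneous_iff_scaleHom.1 hh
  rw [h2, coe_eval₂RingHom, eval₂_mul, eval₂_C, eval₂_pow, eval₂_X, mul_comm]

/-- The point of the line through `(0 : 0 : 1)` and `linePoint l c` with last coordinate `z`. -/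
def planePoint (l : Fin 2) (c z : K) : Fin 3 → K := ![linePoint l c 0, linePoint l c 1, z]

theorem planePoint_ne_zero (l : Fin 2) (c z : K) : planePoint l c z ≠ 0 := by
  intro h
  have h0 := congrFun h 0
  have h1 := congrFun h 1
  fin_cases l <;> simp [planePoint, linePoint] at h0 h1

theorem eval_planePoint (l : Fin 2) (c z : K) (p : Fin 4 → MvPolynomial (Fin 3) K) (i : Fin 4) :
    MvPolynomial.eval (planePoint l c z) (p i) = (restrictLine p l c i).eval z := by
  have h : MvPolynomial.eval (planePoint l c z) = ((evalRingHom z).comp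
      (mapRingHom (MvPolynomial.eval (linePoint l c)))).comp (polyT₃ (K := K)).toRingHom := by
    apply MvPolynomial.ringHom_ext
    · intro r
      simp [polyT₃, Polynomial.algebraMap_apply]
    · intro i
      fin_cases i <;> simp [polyT₃, planePoint]
  rw [h]
  rfl

variable {p : Fin 4 → MvPolynomial (Fin 3) K} {n : ℕ}

theorem mk_mem_basePoints (hhom : ∀ i, (p i).IsHomogeneous n) {v : Fin 3 → K} (hv : v ≠ 0) :
    Projectivization.mk K v hv ∈ basePoints p ↔ ∀ i, MvPolynomial.eval v (p i) = 0 := by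
  obtain ⟨a, ha⟩ := Projectivization.exists_smul_eq_mk_rep K v hv
  rw [basePoints, Set.mem_ofPred_eq, ← ha]
  refine forall_congr' fun i => ?_
  rw [Units.smul_def, eval_smul_of_isHomogeneous (hhom i)]
  simp

/-- The centre `(0:0:1)` is not a base point, so `t₁, t₂` are not both zero: scale to `t₁ = 1`, or
to `t₂ = 1` when `t₁ = 0`. -/
theorem exists_planePoint_of_mem_basePoints (hhom : ∀ i, (p i).IsHomogeneous n)
    (hpt : MvPolynomial.eval ![0, 0, 1] (p 3) ≠ 0) {A : Projectivization K (Fin 3 → K)}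
    (hA : A ∈ basePoints p) :
    (∃ c z, A = .mk K _ (planePoint_ne_zero 1 c z)) ∨
      ∃ z, A = .mk K _ (planePoint_ne_zero 0 0 z) := by
  have key : ∀ w (hw : w ≠ 0) (a : K), a • w = A.rep → A = .mk K w hw := by
    intro w hw a ha
    rw [← A.mk_rep, Projectivization.mk_eq_mk_iff']
    exact ⟨a, ha⟩
  by_cases h0 : A.rep 0 = 0
  · by_cases h1 : A.rep 1 = 0
    · exfalso
      have h2 : A.rep = A.rep 2 • ![0, 0, 1] := by
        funext i
        fin_cases i <;> simp [h0, h1]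
      have h3 := hA 3
      rw [h2, eval_smul_of_isHomogeneous (hhom 3)] at h3
      rcases mul_eq_zero.1 h3 with h3 | h3
      · apply A.rep_nonzero
        rw [h2, eq_zero_of_pow_eq_zero h3, zero_smul]
      · exact hpt h3
    · right
      refine ⟨A.rep 2 / A.rep 1, key _ _ (A.rep 1) ?_⟩
      funext i
      fin_cases i
      · simp [planePoint, linePoint, h0]
      · simp [planePoint, linePoint]
      · simp [planePoint, mul_div_cancel₀ _ h1]
  · left
    refine ⟨A.rep 1 / A.rep 0, A.rep 2 / A.rep 0, key _ _ (A.rep 0) ?_⟩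
    funext i
    fin_cases i
    · simp [planePoint, linePoint]
    · simp [planePoint, linePoint, mul_div_cancel₀ _ h0]
    · simp [planePoint, mul_div_cancel₀ _ h0]

/-- `chart` selects the first nonzero coordinate, so for `l = 0` it agrees with the chart of the
line only if `c = 0`. The scalar relating the representative to `planePoint` cancels in the affine
coordinates. -/
theorem basePointMult_mk_planePoint (l : Fin 2) (c z : K) (h : l = 1 ∨ l = 0 ∧ c = 0) :
    basePointMult p (.mk K _ (planePoint_ne_zero l c z)) =
      affineMult
        (dehomogenize (1 - l).castSucc (MvPolynomial.map (algebraMap (KXY K) (BigF K)) (W₁ p)))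
        (dehomogenize (1 - l).castSucc (MvPolynomial.map (algebraMap (KXY K) (BigF K)) (W₂ p)))
        ![algebraMap K (BigF K) c, algebraMap K (BigF K) z] := by
  obtain ⟨a, ha⟩ := Projectivization.exists_smul_eq_mk_rep K _ (planePoint_ne_zero l c z)
  rw [basePointMult, ← ha]
  set w : Fin 3 → BigF K := fun j => algebraMap K (BigF K) ((a • planePoint l c z) j) with hw
  have ha0 : algebraMap K (BigF K) a ≠ 0 := by simp
  have hchart : chart w = (1 - l).castSucc := by
    rcases h with rfl | ⟨rfl, rfl⟩
    · rw [chart, if_pos]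
      · rfl
      · simp [hw, planePoint, linePoint, Units.smul_def]
    · rw [chart, if_neg, if_pos]
      · rfl
      · simp [hw, planePoint, linePoint, Units.smul_def]
      · simp [hw, planePoint, linePoint, Units.smul_def]
  have hpoint : affinePoint (1 - l).castSucc w =
      ![algebraMap K (BigF K) c, algebraMap K (BigF K) z] := by
    funext j
    rcases h with rfl | ⟨rfl, rfl⟩ <;> fin_cases j <;>
      simp [affinePoint, hw, planePoint, linePoint, Units.smul_def, Fin.succAbove, ha0]
  rw [intersectionMult, hchart, hpoint]

end BasePoints

end BaseLocus

namespace BaseLocus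

open Polynomial

/-! ### Summation over the base points -/

section Main

universe u

variable {K : Type u} [Field K] {p : Fin 4 → MvPolynomial (Fin 3) K} {n : ℕ}

open Classical in
/-- The last coordinates of the base points on the line through `(0 : 0 : 1)` and
`linePoint l c`. -/
def lineBasePoints (p : Fin 4 → MvPolynomial (Fin 3) K) (l : Fin 2) (c : K) : Finset K :=
  (restrictLine p l c 3).roots.toFinset.filter fun z => ∀ i, (restrictLine p l c i).eval z = 0

theorem mem_lineBasePoints (hhom : ∀ i, (p i).IsHomogeneous n)
    (hpt : MvPolynomial.eval ![0, 0, 1] (p 3) ≠ 0) (l : Fin 2) (c z : K) :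
    z ∈ lineBasePoints p l c ↔ ∀ i, (restrictLine p l c i).eval z = 0 := by
  classical
  rw [lineBasePoints, Finset.mem_filter, Multiset.mem_toFinset,
    mem_roots (restrictLine_ne_zero hhom hpt l c)]
  exact ⟨fun h => h.2, fun h => ⟨h 3, h⟩⟩

theorem mk_planePoint_mem_basePoints (hhom : ∀ i, (p i).IsHomogeneous n)
    (hpt : MvPolynomial.eval ![0, 0, 1] (p 3) ≠ 0) (l : Fin 2) (c z : K) :
    Projectivization.mk K _ (planePoint_ne_zero l c z) ∈ basePoints p ↔
      z ∈ lineBasePoints p l c := by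
  rw [mk_mem_basePoints hhom, mem_lineBasePoints hhom hpt]
  simp only [eval_planePoint]

theorem mk_planePoint_one_injective {c z c' z' : K}
    (h : Projectivization.mk K _ (planePoint_ne_zero 1 c z) =
      .mk K _ (planePoint_ne_zero 1 c' z')) : c = c' ∧ z = z' := by
  obtain ⟨a, ha⟩ := (Projectivization.mk_eq_mk_iff' _ _ _ _ _).1 h
  have h0 := congrFun ha 0
  have h1 := congrFun ha 1
  have h2 := congrFun ha 2
  simp [planePoint, linePoint] at h0 h1 h2
  subst h0
  simp at h1 h2
  exact ⟨h1.symm, h2.symm⟩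

theorem mk_planePoint_zero_injective {z z' : K}
    (h : Projectivization.mk K _ (planePoint_ne_zero 0 0 z) =
      .mk K _ (planePoint_ne_zero 0 0 z')) : z = z' := by
  obtain ⟨a, ha⟩ := (Projectivization.mk_eq_mk_iff' _ _ _ _ _).1 h
  have h1 := congrFun ha 1
  have h2 := congrFun ha 2
  simp [planePoint, linePoint] at h1 h2
  subst h1
  simp at h2
  exact h2.symm

theorem mk_planePoint_one_ne_zero (c z z' : K) :
    Projectivization.mk K _ (planePoint_ne_zero 1 c z) ≠
      .mk K _ (planePoint_ne_zero 0 0 z') := by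
  intro h
  obtain ⟨a, ha⟩ := (Projectivization.mk_eq_mk_iff' _ _ _ _ _).1 h
  have h0 := congrFun ha 0
  simp [planePoint, linePoint] at h0

/-- The multiplicity of the base locus is the degree of the content of the resultant. -/
theorem baseLocusMult_eq_totalDegree [IsAlgClosed K]
    (hhom : ∀ i, (p i).IsHomogeneous n) (hgcd : GcdEqOne p)
    (hpt : MvPolynomial.eval ![0, 0, 1] (p 3) ≠ 0) :
    (basePoints p).Finite ∧
      baseLocusMult p = ((contentXY (resT₃ (W₁ p) (W₂ p))).totalDegree : ℕ∞) := by
  classical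
  set H := contentXY (resT₃ (W₁ p) (W₂ p)) with hH
  have hR0 := resT₃_W_ne_zero hgcd hhom hpt
  have hH0 : H ≠ 0 := contentXY_ne_zero hR0
  have hHhom : ∃ d, H.IsHomogeneous d := by
    obtain ⟨m, hm⟩ := MvPolynomial.ne_zero_iff.1 hR0
    obtain ⟨q, hq⟩ := contentXY_dvd_coeff (resT₃ (W₁ p) (W₂ p)) m
    have h1 := isHomogeneous_coeff_resT₃ hhom hpt m
    rw [hq] at h1 hm
    exact (exists_isHomogeneous_of_mul hm h1).1
  obtain ⟨d, hd⟩ := hHhom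
  have hsum := fun l c => sum_affineMult_eq_rootMultiplicity_content (F := BigF K)
    (algebraMap_algebraicClosure_injective (KXY K)) hgcd hhom hpt l c _
    (mem_lineBasePoints hhom hpt l c)
  let S : Finset K := (lineEval 1 H).roots.toFinset
  have hS : ∀ c, (lineEval 1 H).eval c = 0 → c ∈ S := fun c hc =>
    Multiset.mem_toFinset.2 ((mem_roots (lineEval_ne_zero hd hH0 1)).2 hc)
  let f₁ : (Σ _ : K, K) → Projectivization K (Fin 3 → K) := fun x =>
    .mk K _ (planePoint_ne_zero 1 x.1 x.2)
  let f₀ : K → Projectivization K (Fin 3 → K) := fun z => .mk K _ (planePoint_ne_zero 0 0 z)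
  have hf₁ : Function.Injective f₁ := by
    rintro ⟨c, z⟩ ⟨c', z'⟩ h
    obtain ⟨rfl, rfl⟩ := mk_planePoint_one_injective h
    rfl
  have hf₀ : Function.Injective f₀ := fun z z' h => mk_planePoint_zero_injective h
  let T₁ := (S.sigma fun c => lineBasePoints p 1 c).image f₁
  let T₀ := (lineBasePoints p 0 0).image f₀
  have hdisj : Disjoint T₁ T₀ := by
    rw [Finset.disjoint_left]
    intro A h1 h0
    obtain ⟨x, -, rfl⟩ := Finset.mem_image.1 h1
    obtain ⟨z, -, hz⟩ := Finset.mem_image.1 h0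
    exact mk_planePoint_one_ne_zero _ _ _ hz.symm
  -- A base point on the line `(1:c)` forces `H` to vanish at `c`, so only the finitely many `c` in
  -- `S` occur; each line carries finitely many base points.
  have hbase : basePoints p = ((T₁ ∪ T₀ : Finset _) : Set (Projectivization K (Fin 3 → K))) := by
    ext A
    rw [Finset.mem_coe, Finset.mem_union, Finset.mem_image, Finset.mem_image]
    constructor
    · intro hA
      rcases exists_planePoint_of_mem_basePoints hhom hpt hA with ⟨c, z, rfl⟩ | ⟨z, rfl⟩
      · rw [mk_planePoint_mem_basePoints hhom hpt] at hA
        exact Or.inl ⟨⟨c, z⟩, Finset.mem_sigma.2 ⟨hS c ((hsum 1 c).2 ⟨z, hA⟩), hA⟩, rfl⟩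
      · rw [mk_planePoint_mem_basePoints hhom hpt] at hA
        exact Or.inr ⟨z, hA, rfl⟩
    · rintro (⟨x, hx, rfl⟩ | ⟨z, hz, rfl⟩)
      · exact (mk_planePoint_mem_basePoints hhom hpt _ _ _).2 (Finset.mem_sigma.1 hx).2
      · exact (mk_planePoint_mem_basePoints hhom hpt _ _ _).2 hz
  refine ⟨hbase ▸ Finset.finite_toSet _, ?_⟩
  -- Fibrewise comparison with the count of the zeros of `H`: `T₀` gives the multiplicity of
  -- `(0:1)`, and `T₁` gives those of the points `(1:c)`.
  rw [baseLocusMult, hbase, finsum_mem_coe_finset, Finset.sum_union hdisj,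
    Finset.sum_image (fun x _ y _ h => hf₁ h), Finset.sum_image (fun x _ y _ h => hf₀ h),
    Finset.sum_sigma, hd.totalDegree hH0, ← degree_eq_sum_rootMultiplicity hd hH0 S hS,
    Nat.cast_add, Nat.cast_sum, add_comm]
  congr 1
  · rw [← (hsum 0 0).1]
    exact Finset.sum_congr rfl fun z _ => basePointMult_mk_planePoint 0 0 z (Or.inr ⟨rfl, rfl⟩)
  · refine Finset.sum_congr rfl fun c _ => ?_
    rw [← (hsum 1 c).1]
    exact Finset.sum_congr rfl fun z _ => basePointMult_mk_planePoint 1 c z (Or.inl rfl)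

end Main

end BaseLocus

end

theorem mainTheorem2 {K : Type*} [Field K] [IsAlgClosed K] [CharZero K]
    (n : ℕ) (p : Fin 4 → MvPolynomial (Fin 3) K)
    (hhom : ∀ i, (p i).IsHomogeneous n)
    (hgcd : BaseLocus.GcdEqOne p)
    (hp4 : p 3 ≠ 0)
    (hpt : ∀ i, p i ≠ 0 → MvPolynomial.eval ![0, 0, 1] (p i) ≠ 0)
    (L : GL (Fin 4) K) :
    (BaseLocus.basePoints p).Finite ∧
      BaseLocus.baseLocusMult p =
        ((BaseLocus.contentXY
          (BaseLocus.resT₃ (BaseLocus.W₁ (BaseLocus.transform L p))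
            (BaseLocus.W₂ (BaseLocus.transform L p)))).totalDegree : ℕ∞) := by
  rw [BaseLocus.totalDegree_contentXY_transform]
  exact BaseLocus.baseLocusMult_eq_totalDegree hhom hgcd (hpt 3 hp4)
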